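/- **Theorem 7.1 (standard dichotomous Bounded Real Lemma).** Let $\mathcal X,\mathcal U,\mathcal Y$ be complex Hilbert spaces and let $A:\mathcal X\to\mathcal X$, $B:\mathcal U\to\mathcal X$, $C:\mathcal X\to\mathcal Y$, $D:\mathcal U\to\mathcal Y$ be bounded linear operators, defining the system $\Sigma$: $x(n+1)=Ax(n)+Bu(n)$, $y(n)=Cx(n)+Du(n)$ $(n\in\mathbb Z)$, with transfer function $F_\Sigma(z)=D+zC(I-zA)^{-1}B$. Assume that $A$ has no spectrum on the unit circle $\mathbb T$. On the spaces $\ell^2(\mathbb Z)$ of square-summable two-sided sequences with values in $\mathcal X,\mathcal U,\mathcal Y$, let $\mathcal A,\mathcal B,\mathcal C$ be the diagonal operators $(w(n))_n\mapsto(Tw(n))_n$ for $T=A,B,C$ respectively, let $\mathcal S:(x(n))_n\mapsto(x(n-1))_n$ be the bilateral shift, and let $\Pi_0:x\mapsto x(0)$; by the assumption on $A$, the operators $\mathcal S^{-1}-\mathcal A$ and $I-\mathcal S\mathcal A$ are invertible on $\ell^2_{\mathcal X}(\mathbb Z)$. Put $$\mathbf W_c=\Pi_0(\mathcal S^{-1}-\mathcal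 A)^{-1}\mathcal B:\ell^2_{\mathcal U}(\mathbb Z)\to\mathcal X,\qquad \mathbf W_o=\mathcal C(I-\mathcal S\mathcal A)^{-1}\Pi_0^*:\mathcal X\to\ell^2_{\mathcal Y}(\mathbb Z),$$ and assume that $\Sigma$ is dichotomously $\ell^2$-exactly controllable and observable, i.e. that $\mathbf W_c$ and $\mathbf W_o^*$ are surjective. Then $$\sup_{z\in\mathbb T}\|F_\Sigma(z)\|\le 1$$ if and only if there is a bounded, boundedly invertible, selfadjoint operator $H$ on $\mathcal X$ satisfying the KYP inequality $$\begin{bmatrix}A&B\\C&D\end{bmatrix}^*\begin{bmatrix}H&0\\0&I_{\mathcal Y}\end{bmatrix}\begin{bmatrix}A&B\\C&D\end{bmatrix}\preceq\begin{bmatrix}H&0\\0&I_{\mathcal U}\end{bmatrix}.$$ Moreover, for every such $H$, the (Hilbert space) dimension of the spectral subspace of $A$ over the open unit disk equals that of the spectral subspace of $H$ over the positive real line, and the dimension of the spectral subspace of $A$ over the exterior of the closed unit disk equals that of the spectral subspace of $H$ over the negative real line. (Here the spectral subspaces of $A$ are the ranges of the Riesz projection $P=\frac1{2\pi i}\oint_{|z|=1}(zI-A)^{-1}\,dz$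 and of $I-P$, and those of $H$ are the ranges of its spectral projections for $(0,\infty)$ and $(-\infty,0)$.) -/

import Mathlib

open scoped ENNReal

noncomputable section

namespace DichotBRL

universe u

/-! ### Square-summable two-sided sequences -/

section Sequences

theorem memlp_reindex {E : Type*} [NormedAddCommGroup E] (e : ℤ ≃ ℤ)
    (x : lp (fun _ : ℤ => E) 2) :
    Memℓp (fun n : ℤ => x (e n)) 2 := by
  have h := memℓp_gen_iff (p := 2) (by norm_num) |>.1 (lp.memℓp x)
  exact (memℓp_gen_iff (p := 2) (by norm_num)).2
    (e.summable_iff (f := fun n : ℤ => ‖x n‖ ^ (2 : ℝ≥0∞).toReal) |>.2 h)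

variable (E F : Type*) [NormedAddCommGroup E] [InnerProductSpace ℂ E]
  [NormedAddCommGroup F] [InnerProductSpace ℂ F]

/-- The Hilbert space `ℓ²_E(ℤ)` of square-summable two-sided sequences in `E`. -/
abbrev L2Seq : Type _ := lp (fun _ : ℤ => E) 2

variable {E F}

theorem memlp_map (T : E →L[ℂ] F) (x : L2Seq E) :
    Memℓp (fun n : ℤ => T (x n)) 2 := by
  have h := memℓp_gen_iff (p := 2) (by norm_num) |>.1 (lp.memℓp x)
  refine (memℓp_gen_iff (p := 2) (by norm_num)).2 ?_
  refine Summable.of_nonneg_of_le (fun n => by positivity) (fun n => ?_)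
    (h.mul_left (‖T‖ ^ (2 : ℝ≥0∞).toReal))
  rw [← Real.mul_rpow (norm_nonneg _) (norm_nonneg _)]
  exact Real.rpow_le_rpow (norm_nonneg _) (T.le_opNorm _) (by norm_num)

theorem norm_map_le (T : E →L[ℂ] F) (x : L2Seq E) :
    ‖(⟨fun n : ℤ => T (x n), memlp_map T x⟩ : L2Seq F)‖ ≤ ‖T‖ * ‖x‖ := by
  have hp : 0 < (2 : ℝ≥0∞).toReal := by norm_num
  refine lp.norm_le_of_forall_sum_le hp (by positivity) (fun s => ?_)
  rw [Real.mul_rpow (norm_nonneg _) (norm_nonneg _)]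
  calc ∑ i ∈ s, ‖T (x i)‖ ^ (2 : ℝ≥0∞).toReal
      ≤ ∑ i ∈ s, ‖T‖ ^ (2 : ℝ≥0∞).toReal * ‖x i‖ ^ (2 : ℝ≥0∞).toReal := by
        refine Finset.sum_le_sum (fun i _ => ?_)
        rw [← Real.mul_rpow (norm_nonneg _) (norm_nonneg _)]
        exact Real.rpow_le_rpow (norm_nonneg _) (T.le_opNorm _) hp.le
    _ = ‖T‖ ^ (2 : ℝ≥0∞).toReal * ∑ i ∈ s, ‖x i‖ ^ (2 : ℝ≥0∞).toReal := by
        rw [Finset.mul_sum]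
    _ ≤ ‖T‖ ^ (2 : ℝ≥0∞).toReal * ‖x‖ ^ (2 : ℝ≥0∞).toReal := by
        gcongr
        exact lp.sum_rpow_le_norm_rpow hp x s

/-- The diagonal operator `diag_{k ∈ ℤ}[T]`, `(x(n))_n ↦ (T x(n))_n`, from `ℓ²_E(ℤ)` to
`ℓ²_F(ℤ)`. -/
def diagOp (T : E →L[ℂ] F) : L2Seq E →L[ℂ] L2Seq F :=
  LinearMap.mkContinuous
    { toFun := fun x => ⟨fun n : ℤ => T (x n), memlp_map T x⟩
      map_add' := fun x y => by ext n; exact map_add T (x n) (y n)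
      map_smul' := fun c x => by ext n; exact map_smul T c (x n) }
    ‖T‖ (norm_map_le T)

variable (E)

/-- The bilateral shift `S : (x(n))_n ↦ (x(n-1))_n`, a unitary operator on `ℓ²_E(ℤ)`; its inverse
is `S⁻¹ : (x(n))_n ↦ (x(n+1))_n`. -/
def bilateralShift : L2Seq E ≃ₗᵢ[ℂ] L2Seq E where
  toFun x := ⟨fun n : ℤ => x (n - 1), memlp_reindex (Equiv.subRight 1) x⟩
  invFun x := ⟨fun n : ℤ => x (n + 1), memlp_reindex (Equiv.addRight 1) x⟩
  map_add' x y := rfl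
  map_smul' c x := rfl
  left_inv x := by ext n; exact congrArg (fun k : ℤ => x k) (add_sub_cancel_right n 1)
  right_inv x := by ext n; exact congrArg (fun k : ℤ => x k) (sub_add_cancel n 1)
  norm_map' x := by
    have hp : 0 < (2 : ℝ≥0∞).toReal := by norm_num
    rw [lp.norm_eq_tsum_rpow hp, lp.norm_eq_tsum_rpow hp]
    congr 1
    exact (Equiv.subRight (1 : ℤ)).tsum_eq (fun n : ℤ => ‖x n‖ ^ (2 : ℝ≥0∞).toReal)

/-- `S` as a bounded operator. -/
def shiftOp : L2Seq E →L[ℂ] L2Seq E :=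
  (bilateralShift E).toContinuousLinearEquiv.toContinuousLinearMap

/-- `S⁻¹` as a bounded operator. -/
def shiftInvOp : L2Seq E →L[ℂ] L2Seq E :=
  (bilateralShift E).symm.toContinuousLinearEquiv.toContinuousLinearMap

end Sequences

/-! ### The system `x(n+1) = A x(n) + B u(n)`, `y(n) = C x(n) + D u(n)` -/

section System

variable {X U Y : Type*}
  [NormedAddCommGroup X] [InnerProductSpace ℂ X] [CompleteSpace X]
  [NormedAddCommGroup U] [InnerProductSpace ℂ U] [CompleteSpace U]
  [NormedAddCommGroup Y] [InnerProductSpace ℂ Y] [CompleteSpace Y]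

/-- `A` admits a dichotomy: it has no spectrum on the unit circle. -/
def HasDichotomy (A : X →L[ℂ] X) : Prop :=
  Disjoint (spectrum ℂ A) (Metric.sphere (0 : ℂ) 1)

/-- The controllability operator `W_c u = Π₀ (S⁻¹ - 𝒜)⁻¹ ℬ u`, where `𝒜` and `ℬ` are the diagonal
operators of `A` and `B` and `Π₀ x = x(0)`. For `A` with a dichotomy `S⁻¹ - 𝒜` is invertible. -/
def controllabilityOp (A : X →L[ℂ] X) (B : U →L[ℂ] X) : L2Seq U →L[ℂ] X :=
  (lp.evalCLM ℂ (fun _ : ℤ => X) 2 0) ∘L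
    Ring.inverse (shiftInvOp X - diagOp A) ∘L diagOp B

/-- The observability operator `W_o x = 𝒞 (I - S𝒜)⁻¹ Π₀^* x`, where `Π₀^* x` is the sequence with
`x` at position `0` and zeros elsewhere. For `A` with a dichotomy `I - S𝒜` is invertible. -/
def observabilityOp (C : X →L[ℂ] Y) (A : X →L[ℂ] X) : X →L[ℂ] L2Seq Y :=
  diagOp C ∘L Ring.inverse (1 - shiftOp X ∘L diagOp A) ∘L
    lp.singleContinuousLinearMap ℂ (fun _ : ℤ => X) 2 0

/-- Dichotomous `ℓ²`-exact controllability: `W_c` maps onto `X`. -/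
def ExactlyControllable (A : X →L[ℂ] X) (B : U →L[ℂ] X) : Prop :=
  Function.Surjective (controllabilityOp A B)

/-- Dichotomous `ℓ²`-exact observability: the adjoint of `W_o` maps onto `X`. -/
def ExactlyObservable (C : X →L[ℂ] Y) (A : X →L[ℂ] X) : Prop :=
  Function.Surjective (ContinuousLinearMap.adjoint (observabilityOp C A))

/-- The transfer function `F(z) = D + z C (I - z A)⁻¹ B`. -/
def transferFunction (A : X →L[ℂ] X) (B : U →L[ℂ] X) (C : X →L[ℂ] Y) (D : U →L[ℂ] Y) (z : ℂ) :
    U →L[ℂ] Y :=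
  D + z • (C ∘L Ring.inverse (1 - z • A) ∘L B)

/-- The supremum of `‖F(z)‖` over the unit circle, as an extended nonnegative real. -/
def supNormOnCircle (F : ℂ → U →L[ℂ] Y) : ℝ≥0∞ :=
  ⨆ z ∈ Metric.sphere (0 : ℂ) 1, ‖F z‖ₑ

end System

/-! ### Block operators and the KYP inequality -/

section KYP

/-- The block operator `[P Q; R S] : X ⊕ U → Z ⊕ Y` between Hilbert space direct sums. -/
def blockOp {X U Z Y : Type*}
    [NormedAddCommGroup X] [InnerProductSpace ℂ X] [NormedAddCommGroup U] [InnerProductSpace ℂ U]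
    [NormedAddCommGroup Z] [InnerProductSpace ℂ Z] [NormedAddCommGroup Y] [InnerProductSpace ℂ Y]
    (P : X →L[ℂ] Z) (Q : U →L[ℂ] Z) (R : X →L[ℂ] Y) (S : U →L[ℂ] Y) :
    WithLp 2 (X × U) →L[ℂ] WithLp 2 (Z × Y) :=
  (WithLp.prodContinuousLinearEquiv 2 ℂ Z Y).symm.toContinuousLinearMap ∘L
    ((P.coprod Q).prod (R.coprod S)) ∘L
      (WithLp.prodContinuousLinearEquiv 2 ℂ X U).toContinuousLinearMap

variable {X U Y : Type*}
  [NormedAddCommGroup X] [InnerProductSpace ℂ X] [CompleteSpace X]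
  [NormedAddCommGroup U] [InnerProductSpace ℂ U] [CompleteSpace U]
  [NormedAddCommGroup Y] [InnerProductSpace ℂ Y] [CompleteSpace Y]

/-- The KYP inequality
`[A B; C D]^* [H 0; 0 I_Y] [A B; C D] ≤ [H 0; 0 I_U]` in the order of selfadjoint operators. -/
def KYPInequality (A : X →L[ℂ] X) (B : U →L[ℂ] X) (C : X →L[ℂ] Y) (D : U →L[ℂ] Y)
    (H : X →L[ℂ] X) : Prop :=
  ContinuousLinearMap.adjoint (blockOp A B C D) ∘L
      blockOp H 0 0 (ContinuousLinearMap.id ℂ Y) ∘L blockOp A B C D ≤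
    blockOp H 0 0 (ContinuousLinearMap.id ℂ U)

/-- `H` is a bounded, boundedly invertible, selfadjoint solution of the KYP inequality. -/
structure IsKYPSolution (A : X →L[ℂ] X) (B : U →L[ℂ] X) (C : X →L[ℂ] Y) (D : U →L[ℂ] Y)
    (H : X →L[ℂ] X) : Prop where
  selfAdjoint : IsSelfAdjoint H
  invertible : IsUnit H
  kyp : KYPInequality A B C D H

end KYP

/-! ### Spectral subspaces and their dimensions -/

section Spectral

variable {X : Type*} [NormedAddCommGroup X] [InnerProductSpace ℂ X] [CompleteSpace X]

/-- The Riesz projection `(2πi)⁻¹ ∮_{|z| = 1} (zI - A)⁻¹ dz` of `A` for the open unit disk. -/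
def rieszProjection (A : X →L[ℂ] X) : X →L[ℂ] X :=
  (2 * Real.pi * Complex.I : ℂ)⁻¹ • ∮ z in C(0, 1), resolvent A z

/-- The spectral subspace of `A` over the open unit disk, when `A` has a dichotomy. -/
def spectralSubspaceDisk (A : X →L[ℂ] X) : Submodule ℂ X :=
  (rieszProjection A).range

/-- The spectral subspace of `A` over the exterior of the closed unit disk, when `A` has a
dichotomy: the range of the complementary Riesz projection. -/
def spectralSubspaceExterior (A : X →L[ℂ] X) : Submodule ℂ X :=
  (1 - rieszProjection A).range

/-- The spectral subspace of an invertible selfadjoint `H` over the positive real line, the range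
of the spectral projection `1_{(0,∞)}(H)`; this function is continuous on the spectrum of `H`. -/
def spectralSubspacePos (H : X →L[ℂ] X) : Submodule ℂ X :=
  (cfc (Set.indicator (Set.Ioi (0 : ℝ)) 1 : ℝ → ℝ) H).range

/-- The spectral subspace of an invertible selfadjoint `H` over the negative real line, the range
of the spectral projection `1_{(-∞,0)}(H)`. -/
def spectralSubspaceNeg (H : X →L[ℂ] X) : Submodule ℂ X :=
  (cfc (Set.indicator (Set.Iio (0 : ℝ)) 1 : ℝ → ℝ) H).range

/-- The Hilbert space dimension: the (least) cardinality of an orthonormal basis. -/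
def hilbertDim (E : Type u) [NormedAddCommGroup E] [InnerProductSpace ℂ E] : Cardinal.{u} :=
  sInf {c | ∃ ι : Type u, Nonempty (HilbertBasis ι ℂ E) ∧ Cardinal.mk ι = c}

end Spectral

end DichotBRL

end

/-!
The KYP inequality for `H` says that `q(x) = ⟨Hx, x⟩` is a storage function: it satisfies the
dissipation inequality `q(Ax + Bu) + ‖Cx + Du‖² ≤ q(x) + ‖u‖²` (`kypInequality_iff`).

*From `H` to the bound.* For `|z| = 1` and `x = z (1 - zA)⁻¹ B u` one has `Ax + Bu = z⁻¹ x` and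
`Cx + Du = F(z) u`, so the storage terms cancel (`norm_transferFunction_le_one`).

*From the bound to `H`.* The bound on `F` over the circle gives `∑ ‖y(n)‖² ≤ ∑ ‖u(n)‖²` along every
two-sided square-summable trajectory (`IsTrajectory.tsum_output_le`): the trajectory is truncated
to `[-N, N)`, its `z`-transform obeys the state equation up to boundary terms that tend to zero,
and Parseval's identity for trigonometric polynomials finishes the argument. Hence the available
storage, the supremum of `∑_{n ≥ 0} (‖y(n)‖² - ‖u(n)‖²)` over the trajectories through a given state
at time `0`, is finite: trajectories that meet at time `0` can be concatenated there. Exact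
controllability makes it bounded by a multiple of `‖x‖²`. It obeys the parallelogram law, so it is
the form of a bounded selfadjoint operator (`exists_quadForm_eq`), and concatenation gives the
dissipation inequality (`exists_storage`).

*Invertibility and inertia.* Let `w` be the square-summable solution of
`w(n) - A w(n-1) = δ_{n,0} x`, which exists since `I - S𝒜` is bounded below together with its
adjoint. Then `w(0) = P x` with `P` the Riesz projection (`rieszProjection_apply`), and `𝒞 w` is
`W_o x`. Summing the dissipation inequality with zero input along `w` over `ℤ` telescopes to
`‖W_o x‖² ≤ q(Px) - q((1 - P)x)` (`norm_observabilityOp_sq_le`), where exact observability bounds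
the left-hand side below by a multiple of `‖x‖²`. As the right-hand side is the real part of
`⟨Hx, Px - (1 - P)x⟩`, the operator `H` is invertible (`isUnit_of_dissipation`). Moreover `q` is
positive on the range of `P` and negative on that of `1 - P`, so each spectral projection of `A`
or `H` is injective on the corresponding spectral subspace of the other; bounded injections do not
decrease the Hilbert space dimension (`hilbertDim_spectralSubspace_eq`).
-/

open scoped ENNReal

noncomputable section

namespace DichotBRL

/-! ### Parseval's identity for trigonometric polynomials -/

section Parseval

variable {E : Type*} [NormedAddCommGroup E] [InnerProductSpace ℂ E]

theorem circleIntegrable_zpow (k : ℤ) : CircleIntegrable (fun z : ℂ => z ^ k) 0 1 := by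
  refine ContinuousOn.circleIntegrable zero_le_one fun z hz => ?_
  have hz0 : z ≠ 0 := by rintro rfl; simp at hz
  exact (continuousAt_zpow₀ z k (Or.inl hz0)).continuousWithinAt

theorem circleIntegral_zpow (k : ℤ) :
    (∮ z in C(0, 1), z ^ k) = if k = -1 then 2 * Real.pi * Complex.I else 0 := by
  split_ifs with h
  · subst h
    simpa using circleIntegral.integral_sub_center_inv (0 : ℂ) (R := 1) one_ne_zero
  · simpa using circleIntegral.integral_sub_zpow_of_ne h 0 0 1

theorem circleAverage_zpow (k : ℤ) :
    Real.circleAverage (fun z : ℂ => z ^ k) 0 1 = if k = 0 then 1 else 0 := by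
  rw [Real.circleAverage_eq_circleIntegral one_ne_zero]
  have : (∮ z in C(0, 1), (z - 0)⁻¹ • z ^ k) = ∮ z in C(0, 1), z ^ (k - 1) := by
    refine circleIntegral.integral_congr zero_le_one fun z hz => ?_
    have hz0 : z ≠ 0 := by rintro rfl; simp at hz
    simp only [sub_zero, smul_eq_mul]
    rw [zpow_sub_one₀ hz0, mul_comm]
  rw [this, circleIntegral_zpow]
  have : k - 1 = -1 ↔ k = 0 := by omega
  simp only [this]
  split_ifs with h
  · rw [smul_eq_mul, inv_mul_cancel₀ Complex.two_pi_I_ne_zero]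
  · simp

theorem continuousOn_trigPoly (s : Finset ℤ) (w : ℤ → E) :
    ContinuousOn (fun z : ℂ => ∑ n ∈ s, z ^ n • w n) (Metric.sphere 0 1) := by
  refine continuousOn_finsetSum _ fun n _ z hz => ?_
  have hz0 : z ≠ 0 := by rintro rfl; simp at hz
  exact ((continuousAt_zpow₀ z n (Or.inl hz0)).smul continuousAt_const).continuousWithinAt

/-- Parseval's identity for trigonometric polynomials with coefficients in a Hilbert space. -/
theorem circleAverage_norm_sq_trigPoly (s : Finset ℤ) (w : ℤ → E) :
    Real.circleAverage (fun z : ℂ => ‖∑ n ∈ s, z ^ n • w n‖ ^ 2) 0 1 = ∑ n ∈ s, ‖w n‖ ^ 2 := by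
  have hint : ∀ m n : ℤ, CircleIntegrable (fun z : ℂ => inner ℂ (w m) (w n) • z ^ (n - m)) 0 1 :=
    fun m n => (circleIntegrable_zpow _).const_smul
  have h1 : Set.EqOn (fun z : ℂ => ‖∑ n ∈ s, z ^ n • w n‖ ^ 2)
      (Complex.reCLM ∘ fun z : ℂ => ∑ m ∈ s, ∑ n ∈ s, inner ℂ (w m) (w n) • z ^ (n - m))
      (Metric.sphere 0 |1|) := by
    intro z hz
    have hz1 : ‖z‖ = 1 := by simpa using hz
    have hz0 : z ≠ 0 := by rintro rfl; simp at hz1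
    have hc : (starRingEnd ℂ) z = z⁻¹ := by
      rw [Complex.inv_def, Complex.normSq_eq_norm_sq, hz1]; simp
    simp only [Function.comp_apply]
    rw [← inner_self_eq_norm_sq (𝕜 := ℂ), sum_inner]
    simp only [inner_sum, inner_smul_left, inner_smul_right, map_zpow₀, hc]
    refine congrArg Complex.re
      (Finset.sum_congr rfl fun m _ => Finset.sum_congr rfl fun n _ => ?_)
    rw [zpow_sub₀ hz0, inv_zpow, smul_eq_mul]
    field_simp
  rw [Real.circleAverage_congr_sphere h1, ContinuousLinearMap.circleAverage_comp_comm,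
    Real.circleAverage_fun_sum]
  · have : ∀ m ∈ s, Real.circleAverage
        (fun z : ℂ => ∑ n ∈ s, inner ℂ (w m) (w n) • z ^ (n - m)) 0 1 = inner ℂ (w m) (w m) := by
      intro m hm
      rw [Real.circleAverage_fun_sum fun n _ => hint m n]
      simp only [Real.circleAverage_fun_smul, circleAverage_zpow, sub_eq_zero]
      simp [hm]
    rw [Finset.sum_congr rfl this, map_sum]
    refine Finset.sum_congr rfl fun m _ => ?_
    exact inner_self_eq_norm_sq (𝕜 := ℂ) (w m)
  · exact fun m _ => CircleIntegrable.fun_sum _ fun n _ => hint m n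
  · exact CircleIntegrable.fun_sum _ fun m _ => CircleIntegrable.fun_sum _ fun n _ => hint m n

/-- If `‖f̂(z)‖ ≤ γ ‖ĝ(z)‖ + δ` on the unit circle then `‖f‖² ≤ (γ² + γ δ) ‖g‖² + γ δ + δ²`,
by `2 ‖ĝ‖ ≤ 1 + ‖ĝ‖²` and Parseval's identity. -/
theorem sum_norm_sq_le_of_trigPoly_le {F : Type*} [NormedAddCommGroup F] [InnerProductSpace ℂ F]
    (s : Finset ℤ) (f : ℤ → F) (g : ℤ → E) {γ δ : ℝ} (hγ : 0 ≤ γ) (hδ : 0 ≤ δ)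
    (h : ∀ z : ℂ, ‖z‖ = 1 → ‖∑ n ∈ s, z ^ n • f n‖ ≤ γ * ‖∑ n ∈ s, z ^ n • g n‖ + δ) :
    ∑ n ∈ s, ‖f n‖ ^ 2 ≤ (γ ^ 2 + γ * δ) * ∑ n ∈ s, ‖g n‖ ^ 2 + (γ * δ + δ ^ 2) := by
  have hig : CircleIntegrable (fun z : ℂ => ‖∑ n ∈ s, z ^ n • g n‖ ^ 2) 0 1 :=
    ((continuousOn_trigPoly s g).norm.pow 2).circleIntegrable zero_le_one
  have hif : CircleIntegrable (fun z : ℂ => ‖∑ n ∈ s, z ^ n • f n‖ ^ 2) 0 1 :=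
    ((continuousOn_trigPoly s f).norm.pow 2).circleIntegrable zero_le_one
  have hig' : CircleIntegrable
      (fun z : ℂ => (γ ^ 2 + γ * δ) • ‖∑ n ∈ s, z ^ n • g n‖ ^ 2) 0 1 := hig.const_smul
  have hm := Real.circleAverage_mono hif
    (f₂ := fun z : ℂ => (γ ^ 2 + γ * δ) • ‖∑ n ∈ s, z ^ n • g n‖ ^ 2 + (γ * δ + δ ^ 2))
    (hig'.add (circleIntegrable_const _ _ _)) (fun z hz => by
      have hz1 : ‖z‖ = 1 := by simpa using hz
      have := h z hz1
      have h2 := pow_le_pow_left₀ (norm_nonneg _) this 2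
      simp only [smul_eq_mul]
      nlinarith [mul_nonneg (mul_nonneg hγ hδ) (sq_nonneg (‖∑ n ∈ s, z ^ n • g n‖ - 1))])
  rwa [Real.circleAverage_fun_add hig' (circleIntegrable_const _ _ _),
    Real.circleAverage_fun_smul, Real.circleAverage_const, circleAverage_norm_sq_trigPoly,
    circleAverage_norm_sq_trigPoly] at hm

end Parseval

/-! ### Square-summable trajectories and the multiplier bound -/

section Trajectory

variable {X U Y : Type*}
  [NormedAddCommGroup X] [InnerProductSpace ℂ X]
  [NormedAddCommGroup U] [InnerProductSpace ℂ U]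
  [NormedAddCommGroup Y] [InnerProductSpace ℂ Y]

/-- An `ℓ²`-trajectory of the state equation `x(n+1) = A x(n) + B u(n)`: both the input and the
state are square summable over `ℤ`. -/
structure IsTrajectory (A : X →L[ℂ] X) (B : U →L[ℂ] X) (u : ℤ → U) (x : ℤ → X) : Prop where
  memlp_input : Memℓp u 2
  memlp_state : Memℓp x 2
  state_eq : ∀ n, x (n + 1) = A (x n) + B (u n)

theorem memlp_two_iff {E : Type*} [NormedAddCommGroup E] {f : ℤ → E} :
    Memℓp f 2 ↔ Summable fun n => ‖f n‖ ^ 2 := by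
  rw [memℓp_gen_iff (by norm_num)]
  simp

theorem _root_.Memℓp.summable_norm_sq {E : Type*} [NormedAddCommGroup E] {f : ℤ → E}
    (hf : Memℓp f 2) : Summable fun n => ‖f n‖ ^ 2 := memlp_two_iff.1 hf

theorem memlp_clm {f : ℤ → X} (T : X →L[ℂ] Y) (hf : Memℓp f 2) : Memℓp (fun n => T (f n)) 2 :=
  memlp_map T ⟨f, hf⟩

theorem memlp_comp_equiv {E : Type*} [NormedAddCommGroup E] {f : ℤ → E} (e : ℤ ≃ ℤ)
    (hf : Memℓp f 2) : Memℓp (fun n => f (e n)) 2 :=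
  memlp_reindex e ⟨f, hf⟩

theorem memlp_ite {E : Type*} [NormedAddCommGroup E] {f g : ℤ → E} (p : ℤ → Prop)
    [DecidablePred p] (hf : Memℓp f 2)
    (hg : Memℓp g 2) : Memℓp (fun n => if p n then f n else g n) 2 := by
  rw [memlp_two_iff] at *
  refine Summable.of_nonneg_of_le (fun n => by positivity) (fun n => ?_) (hf.add hg)
  have := sq_nonneg ‖f n‖
  have := sq_nonneg ‖g n‖
  split_ifs <;> linarith

theorem IsTrajectory.memlp_output {A : X →L[ℂ] X} {B : U →L[ℂ] X} {u : ℤ → U} {x : ℤ → X}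
    (h : IsTrajectory A B u x) (C : X →L[ℂ] Y) (D : U →L[ℂ] Y) :
    Memℓp (fun n => C (x n) + D (u n)) 2 :=
  (memlp_clm C h.memlp_state).add (memlp_clm D h.memlp_input)

open Filter Topology

theorem tendsto_Ico_int : Tendsto (fun N : ℕ => Finset.Ico (-(N : ℤ)) N) atTop atTop := by
  simpa using Finset.tendsto_Ico_neg (R := ℤ)

/-- The symmetric boundary values of a square summable sequence tend to zero. -/
theorem tendsto_boundary {E : Type*} [NormedAddCommGroup E] {x : ℤ → E} (hx : Memℓp x 2) :
    Tendsto (fun N : ℕ => ‖x (-(N : ℤ))‖ + ‖x N‖) atTop (𝓝 0) := by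
  have h := hx.summable_norm_sq.tendsto_cofinite_zero
  have h' : Tendsto (fun n => ‖x n‖) cofinite (𝓝 0) := by
    have := h.sqrt
    simpa using this
  have h1 : Tendsto (fun N : ℕ => (N : ℤ)) atTop cofinite := by
    rw [← Nat.cofinite_eq_atTop]; exact Nat.cast_injective.tendsto_cofinite
  have h2 : Tendsto (fun N : ℕ => -(N : ℤ)) atTop cofinite := by
    rw [← Nat.cofinite_eq_atTop]
    exact (neg_injective.comp Nat.cast_injective).tendsto_cofinite
  simpa using (h'.comp h2).add (h'.comp h1)

theorem sum_Ico_zpow_succ (x : ℤ → X) (z : ℂ) (N : ℕ) :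
    ∑ n ∈ Finset.Ico (-(N : ℤ)) N, z ^ (n + 1) • x (n + 1) =
      ∑ n ∈ Finset.Ico (-(N : ℤ)) N, z ^ n • x n +
        (z ^ (N : ℤ) • x N - z ^ (-(N : ℤ)) • x (-(N : ℤ))) := by
  have key : ∀ (f : ℤ → X) (M : ℕ) (a : ℤ),
      ∑ n ∈ Finset.Ico a (a + M), f (n + 1) =
        ∑ n ∈ Finset.Ico a (a + M), f n + (f (a + M) - f a) := by
    intro f M a
    induction M with
    | zero => simp
    | succ M ih =>
      have : Finset.Ico a (a + ((M + 1 : ℕ) : ℤ)) =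
          insert (a + (M : ℤ)) (Finset.Ico a (a + M)) := by
        ext n; simp only [Finset.mem_Ico, Finset.mem_insert]; push_cast; omega
      rw [this, Finset.sum_insert (by simp), Finset.sum_insert (by simp), ih]
      push_cast
      rw [← add_assoc a (M : ℤ) 1]
      abel
  have := key (fun n => z ^ n • x n) (2 * N) (-N)
  have e : -(N : ℤ) + ((2 * N : ℕ) : ℤ) = N := by push_cast; ring
  rwa [e] at this

/-- The `z`-transform of the truncation of a trajectory satisfies the transformed state equation
up to the two boundary terms. -/
theorem IsTrajectory.truncated_transform {A : X →L[ℂ] X} {B : U →L[ℂ] X} {u : ℤ → U} {x : ℤ → X}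
    (h : IsTrajectory A B u x) {z : ℂ} (hz : z ≠ 0) (N : ℕ) :
    (1 - z • A) (∑ n ∈ Finset.Ico (-(N : ℤ)) N, z ^ n • x n) =
      z • B (∑ n ∈ Finset.Ico (-(N : ℤ)) N, z ^ n • u n) +
        (z ^ (-(N : ℤ)) • x (-(N : ℤ)) - z ^ (N : ℤ) • x N) := by
  have h1 := sum_Ico_zpow_succ x z N
  have h2 : ∑ n ∈ Finset.Ico (-(N : ℤ)) N, z ^ (n + 1) • x (n + 1) =
      z • A (∑ n ∈ Finset.Ico (-(N : ℤ)) N, z ^ n • x n) +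
      z • B (∑ n ∈ Finset.Ico (-(N : ℤ)) N, z ^ n • u n) := by
    rw [map_sum, map_sum, Finset.smul_sum, Finset.smul_sum, ← Finset.sum_add_distrib]
    refine Finset.sum_congr rfl fun n _ => ?_
    rw [h.state_eq, map_smul, map_smul, smul_smul, smul_smul, zpow_add_one₀ hz, smul_add,
      mul_comm z]
  rw [h2] at h1
  simp only [sub_apply, one_apply_eq_self, smul_apply]
  linear_combination (norm := module) (-1 : ℂ) • h1

theorem norm_boundary_le (x : ℤ → X) {z : ℂ} (hz : ‖z‖ = 1) (N : ℕ) :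
    ‖z ^ (-(N : ℤ)) • x (-(N : ℤ)) - z ^ (N : ℤ) • x N‖ ≤ ‖x (-(N : ℤ))‖ + ‖x N‖ := by
  refine (norm_sub_le _ _).trans ?_
  rw [norm_smul, norm_smul, norm_zpow, norm_zpow, hz]
  simp

theorem HasDichotomy.isUnit_sub {A : X →L[ℂ] X} (hA : HasDichotomy A) {z : ℂ} (hz : ‖z‖ = 1) :
    IsUnit (algebraMap ℂ (X →L[ℂ] X) z - A) := by
  by_contra hn
  exact Set.disjoint_left.1 hA (show z ∈ spectrum ℂ A from hn) (by simpa using hz)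

theorem HasDichotomy.isUnit_one_sub {A : X →L[ℂ] X} (hA : HasDichotomy A) {z : ℂ}
    (hz : ‖z‖ = 1) : IsUnit (1 - z • A) := by
  have hz0 : z ≠ 0 := by rintro rfl; simp at hz
  have h := hA.isUnit_sub (z := z⁻¹) (by simp [hz])
  have h2 := h.smul (Units.mk0 z hz0)
  convert! h2 using 1
  rw [Units.smul_def, Units.val_mk0, smul_sub, Algebra.algebraMap_eq_smul_one, smul_smul,
    mul_inv_cancel₀ hz0, one_smul]

variable [CompleteSpace X]

/-- The resolvent `(1 - zA)⁻¹` is bounded on the unit circle, by compactness. -/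
theorem HasDichotomy.exists_norm_inverse_le {A : X →L[ℂ] X} (hA : HasDichotomy A) :
    ∃ K : ℝ, 0 ≤ K ∧ ∀ z : ℂ, ‖z‖ = 1 → ‖Ring.inverse (1 - z • A : X →L[ℂ] X)‖ ≤ K := by
  have hc : ContinuousOn (fun z : ℂ => Ring.inverse (1 - z • A)) (Metric.sphere 0 1) := by
    intro z hz
    obtain ⟨v, hv⟩ := hA.isUnit_one_sub (z := z) (by simpa using hz)
    have h1 : ContinuousAt Ring.inverse (1 - z • A) := hv ▸ NormedRing.inverse_continuousAt v
    have h2 : ContinuousAt (fun z : ℂ => 1 - z • A) z := by fun_prop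
    exact (ContinuousAt.comp (f := fun z : ℂ => 1 - z • A) h1 h2).continuousWithinAt
  obtain ⟨K, hK⟩ := (isCompact_sphere (0 : ℂ) 1).exists_bound_of_continuousOn hc
  refine ⟨K, (norm_nonneg _).trans (hK 1 (by simp)), fun z hz => hK z (by simpa using hz)⟩

/-- The time-domain form of a bound on the transfer function over the circle: along every
`ℓ²`-trajectory the energy gain from input to output is at most `γ²`. -/
theorem IsTrajectory.tsum_output_le {A : X →L[ℂ] X} {B : U →L[ℂ] X} {u : ℤ → U} {x : ℤ → X}
    (hA : HasDichotomy A) (h : IsTrajectory A B u x) (C : X →L[ℂ] Y) (D : U →L[ℂ] Y) {γ : ℝ}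
    (hγ : 0 ≤ γ) (hF : ∀ z : ℂ, ‖z‖ = 1 → ‖transferFunction A B C D z‖ ≤ γ) :
    ∑' n, ‖C (x n) + D (u n)‖ ^ 2 ≤ γ ^ 2 * ∑' n, ‖u n‖ ^ 2 := by
  obtain ⟨K, hK0, hK⟩ := hA.exists_norm_inverse_le
  set δ : ℕ → ℝ := fun N => ‖C‖ * K * (‖x (-(N : ℤ))‖ + ‖x N‖) with hδ
  have hδ0 : ∀ N, 0 ≤ δ N := fun N => by positivity
  have hδl : Tendsto δ atTop (𝓝 0) := by
    simpa using (tendsto_boundary h.memlp_state).const_mul (‖C‖ * K)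
  have hN : ∀ N : ℕ, ∑ n ∈ Finset.Ico (-(N : ℤ)) N, ‖C (x n) + D (u n)‖ ^ 2 ≤
      (γ ^ 2 + γ * δ N) * ∑ n ∈ Finset.Ico (-(N : ℤ)) N, ‖u n‖ ^ 2 + (γ * δ N + δ N ^ 2) := by
    intro N
    refine sum_norm_sq_le_of_trigPoly_le _ _ _ hγ (hδ0 N) fun z hz => ?_
    have hz0 : z ≠ 0 := by rintro rfl; simp at hz
    set xh := ∑ n ∈ Finset.Ico (-(N : ℤ)) N, z ^ n • x n
    set uh := ∑ n ∈ Finset.Ico (-(N : ℤ)) N, z ^ n • u n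
    have ht := h.truncated_transform hz0 N
    set r := z ^ (-(N : ℤ)) • x (-(N : ℤ)) - z ^ (N : ℤ) • x N
    have hr : ‖r‖ ≤ ‖x (-(N : ℤ))‖ + ‖x N‖ := norm_boundary_le x hz N
    have hx : xh = Ring.inverse (1 - z • A : X →L[ℂ] X) (z • B uh + r) := by
      have := congrArg (fun v => Ring.inverse (1 - z • A : X →L[ℂ] X) v) ht
      rwa [← mul_apply_eq_comp, Ring.inverse_mul_cancel _ (hA.isUnit_one_sub hz)] at this
    have hy : ∑ n ∈ Finset.Ico (-(N : ℤ)) N, z ^ n • (C (x n) + D (u n)) =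
        transferFunction A B C D z uh + C (Ring.inverse (1 - z • A : X →L[ℂ] X) r) := by
      have : ∑ n ∈ Finset.Ico (-(N : ℤ)) N, z ^ n • (C (x n) + D (u n)) = C xh + D uh := by
        simp only [xh, uh, map_sum, map_smul, smul_add, Finset.sum_add_distrib]
      rw [this, hx]
      simp only [transferFunction, map_add, map_smul, add_apply,
        smul_apply, ContinuousLinearMap.comp_apply]
      abel
    rw [hy]
    refine (norm_add_le _ _).trans (add_le_add ?_ ?_)
    · exact (ContinuousLinearMap.le_opNorm _ _).trans
        (mul_le_mul_of_nonneg_right (hF z hz) (norm_nonneg _))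
    · calc ‖C (Ring.inverse (1 - z • A : X →L[ℂ] X) r)‖
          ≤ ‖C‖ * (‖Ring.inverse (1 - z • A : X →L[ℂ] X)‖ * ‖r‖) :=
            C.le_opNorm_of_le (ContinuousLinearMap.le_opNorm _ _)
        _ ≤ ‖C‖ * (K * (‖x (-(N : ℤ))‖ + ‖x N‖)) := by gcongr; exact hK z hz
        _ = δ N := by rw [hδ]; ring
  have l1 := (h.memlp_output C D).summable_norm_sq.hasSum.comp tendsto_Ico_int
  have l2 := h.memlp_input.summable_norm_sq.hasSum.comp tendsto_Ico_int
  have l3 := (((hδl.const_mul γ).const_add (γ ^ 2)).mul l2).add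
    ((hδl.const_mul γ).add (hδl.pow 2))
  have := le_of_tendsto_of_tendsto' l1 l3 hN
  simpa using this

end Trajectory

/-! ### Invertibility over `ℓ²(ℤ)`, the Green's function and the Riesz projection -/

section Dichotomy

open Filter Topology ContinuousLinearMap

variable {X U : Type*}
  [NormedAddCommGroup X] [InnerProductSpace ℂ X] [CompleteSpace X]
  [NormedAddCommGroup U] [InnerProductSpace ℂ U] [CompleteSpace U]

/-- A bounded-below operator with trivial cokernel is invertible. -/
theorem isUnit_of_norm_le {T : X →L[ℂ] X} (K : ℝ) (h : ∀ v, ‖v‖ ≤ K * ‖T v‖)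
    (h' : ∀ v, adjoint T v = 0 → v = 0) : IsUnit T := by
  have hK : ∀ v, ‖v‖ ≤ (Real.toNNReal K : ℝ) * ‖T v‖ := fun v =>
    (h v).trans (mul_le_mul_of_nonneg_right (Real.le_coe_toNNReal K) (norm_nonneg _))
  have ha : AntilipschitzWith (Real.toNNReal K) T := T.antilipschitz_of_bound hK
  rw [ContinuousLinearMap.isUnit_iff_bijective]
  refine ⟨ha.injective, ?_⟩
  have hcl : IsClosed (T.range : Set X) := by
    exact ha.isClosed_range T.uniformContinuous
  have hbot : T.rangeᗮ = ⊥ := by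
    rw [T.orthogonal_range, Submodule.eq_bot_iff]
    exact fun v hv => h' v hv
  have : T.range = ⊤ := by
    have hc : CompleteSpace T.range := hcl.completeSpace_coe
    rwa [Submodule.orthogonal_eq_bot_iff] at hbot
  exact LinearMap.range_eq_top.1 this

theorem HasDichotomy.adjoint {A : X →L[ℂ] X} (hA : HasDichotomy A) :
    HasDichotomy (adjoint A) := by
  rw [HasDichotomy, ← ContinuousLinearMap.star_eq_adjoint, spectrum.map_star, Set.disjoint_left]
  intro z hz hz1
  exact Set.disjoint_left.1 hA (Set.mem_star.1 hz) (by simpa using hz1)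

/-- Under a dichotomy the state of an `ℓ²`-trajectory is controlled by the forcing term. -/
theorem HasDichotomy.exists_tsum_state_le {A : X →L[ℂ] X} (hA : HasDichotomy A) :
    ∃ K : ℝ, 0 ≤ K ∧ ∀ f x : ℤ → X, IsTrajectory A 1 f x →
      ∑' n, ‖x n‖ ^ 2 ≤ K ^ 2 * ∑' n, ‖f n‖ ^ 2 := by
  obtain ⟨K, hK0, hK⟩ := hA.exists_norm_inverse_le
  refine ⟨K, hK0, fun f x h => ?_⟩
  have := h.tsum_output_le hA (1 : X →L[ℂ] X) (0 : X →L[ℂ] X) hK0 fun z hz => by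
    have e : transferFunction A 1 1 0 z = z • Ring.inverse (1 - z • A) := by
      ext v; simp [transferFunction]
    rw [e, norm_smul, hz, one_mul]
    exact hK z hz
  simpa using this

theorem norm_sq_eq_tsum {E : Type*} [NormedAddCommGroup E] (w : lp (fun _ : ℤ => E) 2) :
    ‖w‖ ^ 2 = ∑' n, ‖w n‖ ^ 2 := by
  have := lp.norm_rpow_eq_tsum (p := 2) (by norm_num) w
  simpa using this

theorem one_sub_shift_diag_apply {E : Type*} [NormedAddCommGroup E] [InnerProductSpace ℂ E]
    (A : E →L[ℂ] E) (w : L2Seq E) (n : ℤ) :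
    (1 - shiftOp E ∘L diagOp A) w n = w n - A (w (n - 1)) := rfl

/-- `I - S𝒜` is invertible on `ℓ²(ℤ)` when `A` has a dichotomy: it is bounded below by the
multiplier bound, and so is its adjoint, time reversal turning the kernel of the adjoint into
trajectories of `A^*`. -/
theorem HasDichotomy.isUnit_one_sub_shift_diag {A : X →L[ℂ] X} (hA : HasDichotomy A) :
    IsUnit (1 - shiftOp X ∘L diagOp A) := by
  obtain ⟨K, hK0, hK⟩ := hA.exists_tsum_state_le
  refine isUnit_of_norm_le K (fun w => ?_) fun w hw => ?_
  · set f := (1 - shiftOp X ∘L diagOp A) w with hf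
    have ht : IsTrajectory A 1 (fun n => f (n + 1)) w :=
      ⟨memlp_comp_equiv (Equiv.addRight 1) (lp.memℓp f), lp.memℓp w, fun n => by
        rw [hf, one_sub_shift_diag_apply]; simp⟩
    have h := hK _ _ ht
    have e : ∑' n, ‖f (n + 1)‖ ^ 2 = ∑' n, ‖f n‖ ^ 2 :=
      (Equiv.addRight (1 : ℤ)).tsum_eq fun n => ‖f n‖ ^ 2
    rw [e, ← norm_sq_eq_tsum, ← norm_sq_eq_tsum, ← mul_pow] at h
    exact le_of_sq_le_sq h (by positivity)
  · have hrec : ∀ n, w n = ContinuousLinearMap.adjoint A (w (n + 1)) := by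
      intro n
      refine ext_inner_right ℂ fun a => ?_
      have h0 : inner ℂ w ((1 - shiftOp X ∘L diagOp A) (lp.single 2 n a)) = 0 := by
        rw [← adjoint_inner_left, hw, inner_zero_left]
      have e : (1 - shiftOp X ∘L diagOp A) (lp.single 2 n a) =
          lp.single 2 n a - lp.single 2 (n + 1) (A a) := by
        ext k
        rw [one_sub_shift_diag_apply]
        simp only [lp.coeFn_sub, Pi.sub_apply, lp.single_apply, sub_right_inj]
        rcases eq_or_ne k (n + 1) with rfl | hk
        · simp
        · have : k - 1 ≠ n := by omega
          simp [Pi.single_eq_of_ne, hk, this]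
      rw [e, inner_sub_right, lp.inner_single_right, lp.inner_single_right, sub_eq_zero] at h0
      rw [h0, adjoint_inner_left]
    obtain ⟨K', -, hK'⟩ := hA.adjoint.exists_tsum_state_le
    have ht : IsTrajectory (ContinuousLinearMap.adjoint A) 1 (fun _ => (0 : X))
        (fun n => w (-n)) :=
      ⟨zero_memℓp, memlp_comp_equiv (Equiv.neg ℤ) (lp.memℓp w), fun n => by
        rw [hrec (-(n + 1))]; simp⟩
    have h := hK' _ _ ht
    have e : ∑' n, ‖w (-n)‖ ^ 2 = ∑' n, ‖w n‖ ^ 2 := (Equiv.neg ℤ).tsum_eq fun n => ‖w n‖ ^ 2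
    rw [e, ← norm_sq_eq_tsum] at h
    simp only [norm_zero, ne_eq, OfNat.ofNat_ne_zero, not_false_eq_true, zero_pow, tsum_zero,
      mul_zero] at h
    exact norm_eq_zero.1 (pow_eq_zero_iff two_ne_zero |>.1 (le_antisymm h (sq_nonneg _)))

theorem HasDichotomy.isUnit_shiftInv_sub_diag {A : X →L[ℂ] X} (hA : HasDichotomy A) :
    IsUnit (shiftInvOp X - diagOp A) := by
  have h1 : shiftInvOp X * shiftOp X = 1 :=
    ContinuousLinearMap.ext fun x => (bilateralShift X).symm_apply_apply x
  have h2 : shiftOp X * shiftInvOp X = 1 :=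
    ContinuousLinearMap.ext fun x => (bilateralShift X).apply_symm_apply x
  have hu : IsUnit (shiftInvOp X) := ⟨⟨_, _, h1, h2⟩, rfl⟩
  have : shiftInvOp X - diagOp A = shiftInvOp X * (1 - shiftOp X * diagOp A) := by
    rw [mul_sub, mul_one, ← mul_assoc, h1, one_mul]
  rw [this]
  exact hu.mul hA.isUnit_one_sub_shift_diag

theorem exists_trajectory_of_input {V : Type*} [NormedAddCommGroup V]
    [InnerProductSpace ℂ V] {A : X →L[ℂ] X} (hA : HasDichotomy A) (B : V →L[ℂ] X)
    (u : L2Seq V) : ∃ x : ℤ → X, IsTrajectory A B u x ∧ x 0 = controllabilityOp A B u := by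
  set x : L2Seq X := Ring.inverse (shiftInvOp X - diagOp A) (diagOp B u) with hx
  refine ⟨x, ⟨lp.memℓp u, lp.memℓp x, fun n => ?_⟩, rfl⟩
  have h : (shiftInvOp X - diagOp A) x = diagOp B u := by
    rw [hx, ← mul_apply_eq_comp, Ring.mul_inverse_cancel _ hA.isUnit_shiftInv_sub_diag]; rfl
  have h2 : x (n + 1) - A (x n) = B (u n) := congrArg (fun v : L2Seq X => v n) h
  rw [← h2]; abel

/-- Exact controllability: every state is the state at time `0` of an `ℓ²`-trajectory whose input
energy is bounded by the energy of the state, by the open mapping theorem. -/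
theorem exists_trajectory_of_state {A : X →L[ℂ] X} {B : U →L[ℂ] X} (hA : HasDichotomy A)
    (hc : ExactlyControllable A B) :
    ∃ K : ℝ, 0 ≤ K ∧ ∀ x₀ : X, ∃ (u : ℤ → U) (x : ℤ → X), IsTrajectory A B u x ∧ x 0 = x₀ ∧
      ∑' n, ‖u n‖ ^ 2 ≤ K * ‖x₀‖ ^ 2 := by
  obtain ⟨K, hK, h⟩ := (controllabilityOp A B).exists_preimage_norm_le hc
  refine ⟨K ^ 2, by positivity, fun x₀ => ?_⟩
  obtain ⟨u, hu, hn⟩ := h x₀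
  obtain ⟨x, hx, hx0⟩ := exists_trajectory_of_input hA B u
  refine ⟨u, x, hx, hx0.trans hu, ?_⟩
  rw [← norm_sq_eq_tsum, ← mul_pow]
  exact pow_le_pow_left₀ (norm_nonneg _) hn 2

/-- The map sending a vector `x` to the `ℓ²`-solution `w` of `w(n) - A w(n-1) = δ_{n,0} x`. -/
def greenOp (A : X →L[ℂ] X) : X →L[ℂ] L2Seq X :=
  Ring.inverse (1 - shiftOp X ∘L diagOp A) ∘L
    lp.singleContinuousLinearMap ℂ (fun _ : ℤ => X) 2 0

theorem greenOp_unique {A : X →L[ℂ] X} (hA : HasDichotomy A) {y : X} {v : L2Seq X}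
    (hv : ∀ n, v n - A (v (n - 1)) = if n = 0 then y else 0) : greenOp A y = v := by
  have : (1 - shiftOp X ∘L diagOp A) v = lp.singleContinuousLinearMap ℂ (fun _ : ℤ => X) 2 0 y := by
    ext n
    rw [one_sub_shift_diag_apply, hv]
    simp [Pi.single_apply]
  rw [greenOp, comp_apply, ← this, ← mul_apply_eq_comp,
    Ring.inverse_mul_cancel _ hA.isUnit_one_sub_shift_diag]
  rfl

theorem greenOp_sub {A : X →L[ℂ] X} (hA : HasDichotomy A) (x : X) (n : ℤ) :
    greenOp A x n - A (greenOp A x (n - 1)) = if n = 0 then x else 0 := by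
  rw [← one_sub_shift_diag_apply, greenOp, comp_apply, ← mul_apply_eq_comp,
    Ring.mul_inverse_cancel _ hA.isUnit_one_sub_shift_diag]
  simp [Pi.single_apply]

theorem greenOp_succ {A : X →L[ℂ] X} (hA : HasDichotomy A) (x : X) {n : ℤ} (hn : n ≠ -1) :
    greenOp A x (n + 1) = A (greenOp A x n) := by
  have := greenOp_sub hA x (n + 1)
  rwa [if_neg (by omega), sub_eq_zero, add_sub_cancel_right] at this

theorem isTrajectory_greenOp {A : X →L[ℂ] X} (hA : HasDichotomy A) (x : X) :
    IsTrajectory A 1 (Pi.single (-1) x : ℤ → X) (greenOp A x) := by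
  refine ⟨lp.memℓp (lp.single (E := fun _ : ℤ => X) 2 (-1) x), lp.memℓp _, fun n => ?_⟩
  have := greenOp_sub hA x (n + 1)
  rw [add_sub_cancel_right, sub_eq_iff_eq_add] at this
  rw [this, add_comm]
  have e : n + 1 = 0 ↔ n = -1 := by omega
  simp [Pi.single_apply, e]

theorem continuousOn_resolvent_sphere {A : X →L[ℂ] X} (hA : HasDichotomy A) :
    ContinuousOn (resolvent A) (Metric.sphere (0 : ℂ) 1) := by
  intro z hz
  obtain ⟨v, hv⟩ := hA.isUnit_sub (z := z) (by simpa using hz)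
  have h1 : ContinuousAt Ring.inverse (algebraMap ℂ (X →L[ℂ] X) z - A) :=
    hv ▸ NormedRing.inverse_continuousAt v
  have h2 : ContinuousAt (fun z : ℂ => algebraMap ℂ (X →L[ℂ] X) z - A) z :=
    ((algebraMapCLM ℂ (X →L[ℂ] X)).continuous.sub continuous_const).continuousAt
  exact (ContinuousAt.comp (f := fun z : ℂ => algebraMap ℂ (X →L[ℂ] X) z - A) h1
    h2).continuousWithinAt

theorem clm_circleIntegral_apply {f : ℂ → X →L[ℂ] X} (hf : CircleIntegrable f 0 1) (x : X) :
    (∮ z in C(0, 1), f z) x = ∮ z in C(0, 1), f z x := by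
  have := (ContinuousLinearMap.apply ℂ X x).intervalIntegral_comp_comm hf.out
  simpa [circleIntegral] using this.symm

/-- The Riesz projection is the value at time `0` of the Green's function: the truncated
Fourier series of the Green's function approximate the resolvent uniformly on the circle. -/
theorem rieszProjection_apply {A : X →L[ℂ] X} (hA : HasDichotomy A) (x : X) :
    rieszProjection A x = greenOp A x 0 := by
  set w := greenOp A x with hw
  have ht := isTrajectory_greenOp hA x
  rw [← hw] at ht
  obtain ⟨K, hK0, hK⟩ := hA.exists_norm_inverse_le
  have hres : CircleIntegrable (fun z => resolvent A z) 0 1 :=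
    (continuousOn_resolvent_sphere hA).circleIntegrable zero_le_one
  have hresx : CircleIntegrable (fun z => resolvent A z x) 0 1 :=
    ((continuousOn_resolvent_sphere hA).clm_apply continuousOn_const).circleIntegrable zero_le_one
  have hterm : ∀ n : ℤ, CircleIntegrable (fun z : ℂ => z ^ (-n - 1) • w n) 0 1 := fun n => by
    refine ContinuousOn.circleIntegrable zero_le_one fun z hz => ?_
    have hz0 : z ≠ 0 := by rintro rfl; simp at hz
    exact ((continuousAt_zpow₀ z _ (Or.inl hz0)).smul continuousAt_const).continuousWithinAt
  have hpoly : ∀ N : ℕ, 1 ≤ N →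
      (∮ z in C(0, 1), ∑ n ∈ Finset.Ico (-(N : ℤ)) N, z ^ (-n - 1) • w n) =
        (2 * Real.pi * Complex.I : ℂ) • w 0 := by
    intro N hN
    rw [circleIntegral.integral_fun_sum fun n _ => hterm n]
    simp only [circleIntegral.integral_smul_const, circleIntegral_zpow]
    rw [Finset.sum_eq_single 0]
    · simp
    · intro n _ hn
      rw [if_neg (by omega), zero_smul]
    · intro h
      exact absurd (Finset.mem_Ico.2 ⟨by omega, by omega⟩) h
  have hbound : ∀ N : ℕ, 1 ≤ N →
      ‖(∮ z in C(0, 1), resolvent A z x) - (2 * Real.pi * Complex.I : ℂ) • w 0‖ ≤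
        2 * Real.pi * 1 * (K * (‖w (-(N : ℤ))‖ + ‖w N‖)) := by
    intro N hN
    rw [← hpoly N hN, ← circleIntegral.integral_sub hresx
      (CircleIntegrable.fun_sum _ fun n _ => hterm n)]
    refine circleIntegral.norm_integral_le_of_norm_le_const zero_le_one fun z hz => ?_
    have hz1 : ‖z‖ = 1 := by simpa using hz
    have hz0 : z ≠ 0 := by rintro rfl; simp at hz
    have hi1 : ‖z⁻¹‖ = 1 := by simp [hz1]
    have h1 := ht.truncated_transform (inv_ne_zero hz0) N
    set r := z⁻¹ ^ (-(N : ℤ)) • w (-(N : ℤ)) - z⁻¹ ^ (N : ℤ) • w N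
    have hr : ‖r‖ ≤ ‖w (-(N : ℤ))‖ + ‖w N‖ := norm_boundary_le w hi1 N
    have hin : ∑ n ∈ Finset.Ico (-(N : ℤ)) N, z⁻¹ ^ n • (Pi.single (-1) x : ℤ → X) n = z • x := by
      rw [Finset.sum_eq_single (-1)]
      · simp
      · intro n _ hn
        simp [Pi.single_eq_of_ne hn]
      · intro h
        exact absurd (Finset.mem_Ico.2 ⟨by omega, by omega⟩) h
    set wh := ∑ n ∈ Finset.Ico (-(N : ℤ)) N, z⁻¹ ^ n • w n with hwh
    rw [hin, one_apply_eq_self, smul_smul, inv_mul_cancel₀ hz0, one_smul] at h1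
    set R : X →L[ℂ] X := Ring.inverse (1 - z⁻¹ • A) with hR
    have hu := hA.isUnit_one_sub hi1
    have h2 : R x = wh - R r := by
      have h3 : R ((1 - z⁻¹ • A) wh) = wh := by
        rw [← mul_apply_eq_comp, hR, Ring.inverse_mul_cancel _ hu, one_apply_eq_self]
      rw [h1, map_add] at h3
      rw [← h3]; abel
    have hres' : resolvent A z = z⁻¹ • R := by
      have e : algebraMap ℂ (X →L[ℂ] X) z - A = z • (1 - z⁻¹ • A) := by
        rw [smul_sub, smul_smul, mul_inv_cancel₀ hz0, one_smul, Algebra.algebraMap_eq_smul_one]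
      have h3 : (algebraMap ℂ (X →L[ℂ] X) z - A) * (z⁻¹ • R) = 1 := by
        rw [e, smul_mul_smul_comm, mul_inv_cancel₀ hz0, one_smul, hR, Ring.mul_inverse_cancel _ hu]
      exact (hA.isUnit_sub hz1).mul_left_cancel
        ((Ring.mul_inverse_cancel _ (hA.isUnit_sub hz1)).trans h3.symm)
    have hsum : ∑ n ∈ Finset.Ico (-(N : ℤ)) N, z ^ (-n - 1) • w n = z⁻¹ • wh := by
      rw [hwh, Finset.smul_sum]
      refine Finset.sum_congr rfl fun n _ => ?_
      rw [smul_smul, zpow_sub_one₀ hz0, zpow_neg, inv_zpow, mul_comm]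
    have : resolvent A z x - ∑ n ∈ Finset.Ico (-(N : ℤ)) N, z ^ (-n - 1) • w n = -(z⁻¹ • R r) := by
      rw [hsum, hres', smul_apply, h2, smul_sub]; abel
    rw [this, norm_neg, norm_smul, hi1, one_mul]
    exact (R.le_opNorm r).trans (mul_le_mul (hK _ hi1) hr (norm_nonneg _) hK0)
  have hlim : Tendsto (fun N : ℕ => 2 * Real.pi * 1 * (K * (‖w (-(N : ℤ))‖ + ‖w N‖))) atTop
      (𝓝 0) := by
    simpa using ((tendsto_boundary (lp.memℓp w)).const_mul K).const_mul (2 * Real.pi * 1)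
  have hle := ge_of_tendsto hlim (eventually_atTop.2 ⟨1, hbound⟩)
  have heq := sub_eq_zero.1 (norm_le_zero_iff.1 hle)
  rw [rieszProjection, smul_apply, clm_circleIntegral_apply hres, heq, smul_smul,
    inv_mul_cancel₀ Complex.two_pi_I_ne_zero, one_smul]

theorem rieszProjection_idem {A : X →L[ℂ] X} (hA : HasDichotomy A) (x : X) :
    rieszProjection A (rieszProjection A x) = rieszProjection A x := by
  set w := greenOp A x with hw
  let v : L2Seq X := ⟨fun n => if 0 ≤ n then w n else 0, memlp_ite _ (lp.memℓp w) zero_memℓp⟩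
  have hv : ∀ n, v n = if 0 ≤ n then w n else 0 := fun n => rfl
  have : greenOp A (w 0) = v := greenOp_unique hA fun n => by
    rcases lt_trichotomy n 0 with h | rfl | h
    · simp [hv, h.ne, not_le.2 h, show ¬ (1 : ℤ) ≤ n by omega]
    · simp [hv]
    · have := greenOp_sub hA x n
      rw [if_neg h.ne'] at this
      simp [hv, h.ne', h.le, show (1 : ℤ) ≤ n by omega, hw, this]
  rw [rieszProjection_apply hA x, ← hw, rieszProjection_apply hA, this, hv, if_pos le_rfl]

end Dichotomy

/-! ### Bounded quadratic forms -/

section QuadraticForm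

open ContinuousLinearMap

variable {X : Type*} [NormedAddCommGroup X] [InnerProductSpace ℂ X]

/-- The quadratic form of an operator `H`, i.e. the real part of `⟨Hx, x⟩`. -/
def quadForm (H : X →L[ℂ] X) (x : X) : ℝ := (inner ℂ (H x) x).re

theorem abs_quadForm_le (H : X →L[ℂ] X) (x : X) : |quadForm H x| ≤ ‖H‖ * ‖x‖ ^ 2 :=
  calc |quadForm H x| ≤ ‖inner ℂ (H x) x‖ := Complex.abs_re_le_norm _
    _ ≤ ‖H x‖ * ‖x‖ := norm_inner_le_norm _ _
    _ ≤ ‖H‖ * ‖x‖ * ‖x‖ := by gcongr; exact H.le_opNorm x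
    _ = ‖H‖ * ‖x‖ ^ 2 := by ring

/-- A selfadjoint `H` is invertible if the real part of `⟨Hx, Tx⟩` dominates `‖x‖²` for some bounded
`T`: by Cauchy–Schwarz `H` is then bounded below. -/
theorem isUnit_of_le_re_inner [CompleteSpace X] {H T : X →L[ℂ] X} (hH : IsSelfAdjoint H) {ε : ℝ}
    (hε : 0 < ε)
    (h : ∀ x, ε * ‖x‖ ^ 2 ≤ (inner ℂ (H x) (T x)).re) : IsUnit H := by
  have hb : ∀ v, ‖v‖ ≤ (‖T‖ / ε) * ‖H v‖ := by
    intro v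
    rcases eq_or_ne v 0 with rfl | hv
    · simp
    have hv' : 0 < ‖v‖ := norm_pos_iff.2 hv
    have h1 : ε * ‖v‖ ^ 2 ≤ ‖H v‖ * (‖T‖ * ‖v‖) :=
      (h v).trans <| (Complex.re_le_norm _).trans <| (norm_inner_le_norm _ _).trans <|
        mul_le_mul_of_nonneg_left (T.le_opNorm v) (norm_nonneg _)
    rw [div_mul_eq_mul_div, le_div_iff₀ hε]
    refine le_of_mul_le_mul_right ?_ hv'
    nlinarith
  refine isUnit_of_norm_le _ hb fun v hv => ?_
  rw [hH.adjoint_eq] at hv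
  have := hb v
  rw [hv, norm_zero, mul_zero] at this
  exact norm_le_zero_iff.1 this

/-- The real polar form of a function satisfying the parallelogram law. -/
def polarForm (q : X → ℝ) (x y : X) : ℝ := (q (x + y) - q (x - y)) / 4

variable {q : X → ℝ} {M : ℝ}

theorem polarForm_add_left (hs : ∀ (c : ℂ) x, q (c • x) = ‖c‖ ^ 2 * q x)
    (hp : ∀ x y, q (x + y) + q (x - y) = 2 * q x + 2 * q y) (x y z : X) :
    polarForm q (x + y) z = polarForm q x z + polarForm q y z := by
  have hneg : ∀ x, q (-x) = q x := fun x => by simpa using hs (-1) x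
  have key : ∀ a b, polarForm q (a + b) z + polarForm q (a - b) z = 2 * polarForm q a z := by
    intro a b
    have h1 := hp (a + z) b
    have h2 := hp (a - z) b
    unfold polarForm
    rw [show a + b + z = a + z + b by abel, show a + b - z = a - z + b by abel,
      show a - b + z = a + z - b by abel, show a - b - z = a - z - b by abel]
    linarith
  have hz : polarForm q 0 z = 0 := by simp [polarForm, hneg]
  -- halving the arguments reduces additivity to the identity `key`
  have h1 := key ((2⁻¹ : ℂ) • (x + y)) ((2⁻¹ : ℂ) • (x - y))
  have h2 := key ((2⁻¹ : ℂ) • (x + y)) ((2⁻¹ : ℂ) • (x + y))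
  have e1 : (2⁻¹ : ℂ) • (x + y) + (2⁻¹ : ℂ) • (x - y) = x := by module
  have e2 : (2⁻¹ : ℂ) • (x + y) - (2⁻¹ : ℂ) • (x - y) = y := by module
  have e3 : (2⁻¹ : ℂ) • (x + y) + (2⁻¹ : ℂ) • (x + y) = x + y := by module
  rw [e1, e2] at h1
  rw [e3, sub_self, hz] at h2
  linarith

theorem polarForm_comm (hs : ∀ (c : ℂ) x, q (c • x) = ‖c‖ ^ 2 * q x) (x y : X) :
    polarForm q x y = polarForm q y x := by
  have : q (x - y) = q (y - x) := by
    have := hs (-1) (y - x)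
    simpa using this
  rw [polarForm, polarForm, this, add_comm x y]

theorem abs_polarForm_le_add (hb : ∀ x, |q x| ≤ M * ‖x‖ ^ 2) (x y : X) :
    |polarForm q x y| ≤ M / 2 * (‖x‖ ^ 2 + ‖y‖ ^ 2) := by
  have h1 := abs_le.1 (hb (x + y))
  have h2 := abs_le.1 (hb (x - y))
  have h4 : M * ‖x + y‖ ^ 2 + M * ‖x - y‖ ^ 2 = 2 * M * (‖x‖ ^ 2 + ‖y‖ ^ 2) := by
    linear_combination M * parallelogram_law_with_norm ℂ x y
  rw [abs_le]
  unfold polarForm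
  constructor <;> linarith

/-- Additivity and local boundedness give real homogeneity. -/
theorem polarForm_real_smul_left (hb : ∀ x, |q x| ≤ M * ‖x‖ ^ 2)
    (hs : ∀ (c : ℂ) x, q (c • x) = ‖c‖ ^ 2 * q x)
    (hp : ∀ x y, q (x + y) + q (x - y) = 2 * q x + 2 * q y) (r : ℝ) (x y : X) :
    polarForm q (r • x) y = r * polarForm q x y := by
  let f : X →+ ℝ := AddMonoidHom.mk' (fun x => polarForm q x y)
    fun a b => polarForm_add_left hs hp a b y
  have hf : Continuous f := by
    refine f.continuous_of_isBounded_nhds_zero (Metric.ball_mem_nhds 0 one_pos) ?_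
    refine (Metric.isBounded_closedBall (x := (0 : ℝ)) (r := |M| / 2 * (1 + ‖y‖ ^ 2))).subset ?_
    rintro _ ⟨a, ha, rfl⟩
    rw [mem_closedBall_zero_iff]
    have ha1 : ‖a‖ ^ 2 ≤ 1 := pow_le_one₀ (norm_nonneg _) (mem_ball_zero_iff.1 ha).le
    calc ‖f a‖ ≤ M / 2 * (‖a‖ ^ 2 + ‖y‖ ^ 2) := abs_polarForm_le_add hb a y
      _ ≤ |M| / 2 * (1 + ‖y‖ ^ 2) := by gcongr; exact le_abs_self M
  exact (f.toRealLinearMap hf).map_smul r x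

theorem polarForm_I_smul (hs : ∀ (c : ℂ) x, q (c • x) = ‖c‖ ^ 2 * q x) (x y : X) :
    polarForm q (Complex.I • x) (Complex.I • y) = polarForm q x y := by
  simp [polarForm, ← smul_add, ← smul_sub, hs]

/-- Jordan–von Neumann for bounded, not necessarily positive, forms: a bounded function on a
Hilbert space that is homogeneous of degree two and satisfies the parallelogram law is the
quadratic form of a bounded selfadjoint operator. -/
theorem exists_quadForm_eq [CompleteSpace X] (hb : ∀ x, |q x| ≤ M * ‖x‖ ^ 2)
    (hs : ∀ (c : ℂ) x, q (c • x) = ‖c‖ ^ 2 * q x)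
    (hp : ∀ x y, q (x + y) + q (x - y) = 2 * q x + 2 * q y) :
    ∃ H : X →L[ℂ] X, IsSelfAdjoint H ∧ ∀ x, quadForm H x = q x := by
  have hadd := polarForm_add_left hs hp
  have hcomm := polarForm_comm hs
  have hI := polarForm_I_smul hs
  have hreal := polarForm_real_smul_left hb hs hp
  have hadd' : ∀ x y z, polarForm q x (y + z) = polarForm q x y + polarForm q x z := by
    intro x y z
    rw [hcomm, hadd, hcomm y, hcomm z]
  have hreal' : ∀ (r : ℝ) x y, polarForm q x (r • y) = r * polarForm q x y := by
    intro r x y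
    rw [hcomm, hreal, hcomm y]
  have hIl : ∀ x y, polarForm q (Complex.I • x) y = -polarForm q x (Complex.I • y) := by
    intro x y
    have h1 := hI x (-(Complex.I • y))
    have h2 : Complex.I • -(Complex.I • y) = y := by
      rw [smul_neg, smul_smul, Complex.I_mul_I, neg_one_smul, neg_neg]
    have h3 := hreal' (-1) x (Complex.I • y)
    rw [neg_one_smul, neg_one_mul] at h3
    rwa [h2, h3] at h1
  have hsmul : ∀ (c : ℂ) (x : X), c • x = c.re • x + c.im • (Complex.I • x) := by
    intro c x
    conv_lhs => rw [← Complex.re_add_im c]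
    rw [add_smul, mul_smul, Complex.coe_smul, Complex.coe_smul]
  have hII : ∀ x : X, Complex.I • (Complex.I • x) = (-1 : ℝ) • x := by
    intro x
    rw [smul_smul, Complex.I_mul_I, neg_one_smul, neg_one_smul]
  let h : X → X → ℂ := fun x y => polarForm q x y - Complex.I * polarForm q x (Complex.I • y)
  let L : X →ₗ⋆[ℂ] X →ₗ[ℂ] ℂ := LinearMap.mk₂'ₛₗ (starRingEnd ℂ) (RingHom.id ℂ) h
    (fun x x' y => by simp only [h, hadd]; push_cast; ring)
    (fun c x y => by
      simp only [h, hsmul c x, hadd, hreal, hIl, hII, hreal', smul_eq_mul]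
      apply Complex.ext <;> simp <;> ring)
    (fun x y y' => by simp only [h, smul_add, hadd']; push_cast; ring)
    (fun c x y => by
      simp only [h, hsmul c y, smul_add, smul_comm Complex.I (_ : ℝ), hadd', hII, hreal',
        smul_eq_mul, RingHom.id_apply]
      apply Complex.ext <;> simp
      ring)
  have hL : ∀ x y, L x y = h x y := fun x y => rfl
  have hM : ∀ x y : X, |polarForm q x y| ≤ M * ‖x‖ * ‖y‖ := by
    intro x y
    rcases eq_or_ne x 0 with rfl | hx
    · have := hreal 0 0 y; simp at this; simp [this]
    rcases eq_or_ne y 0 with rfl | hy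
    · have := hreal' 0 x 0; simp at this; simp [this]
    have hx' := norm_pos_iff.2 hx
    have hy' := norm_pos_iff.2 hy
    have h1 := abs_polarForm_le_add hb (‖x‖⁻¹ • x) (‖y‖⁻¹ • y)
    rw [hreal, hreal', norm_smul, norm_smul, norm_inv, norm_inv, norm_norm, norm_norm,
      inv_mul_cancel₀ hx'.ne', inv_mul_cancel₀ hy'.ne', abs_mul, abs_mul, abs_inv, abs_inv,
      abs_norm, abs_norm, ← mul_assoc, ← mul_inv, inv_mul_le_iff₀ (by positivity)] at h1
    linarith
  have hbd : ∀ x y, ‖L x y‖ ≤ (2 * M) * ‖x‖ * ‖y‖ := by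
    intro x y
    rw [hL]
    refine (norm_sub_le _ _).trans ?_
    rw [norm_mul, Complex.norm_I, one_mul, Complex.norm_real, Complex.norm_real, Real.norm_eq_abs,
      Real.norm_eq_abs]
    have h1 := hM x y
    have h2 := hM x (Complex.I • y)
    rw [norm_smul, Complex.norm_I, one_mul] at h2
    linarith
  have hH := InnerProductSpace.continuousLinearMapOfBilin_apply (L.mkContinuous₂ _ hbd)
  refine ⟨InnerProductSpace.continuousLinearMapOfBilin (L.mkContinuous₂ _ hbd), ?_, fun x => ?_⟩
  · rw [ContinuousLinearMap.isSelfAdjoint_iff_isSymmetric]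
    intro x y
    rw [ContinuousLinearMap.coe_coe, ← inner_conj_symm x, hH, hH, LinearMap.mkContinuous₂_apply,
      LinearMap.mkContinuous₂_apply, hL, hL]
    simp only [h]
    rw [hcomm y x, hcomm y, hIl]
    apply Complex.ext <;> simp
  · rw [quadForm, hH, LinearMap.mkContinuous₂_apply, hL]
    have h2 : q (x + x) = 4 * q x := by
      have := hs 2 x
      rw [two_smul] at this
      rw [this]; norm_num
    have h0 : q 0 = 0 := by simpa using hs 0 0
    have : polarForm q x x = q x := by rw [polarForm, h2, sub_self, h0]; ring
    simp [h, this]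

end QuadraticForm

/-! ### The dissipation inequality -/

section Dissipation

open ContinuousLinearMap

variable {X U Y : Type*}
  [NormedAddCommGroup X] [InnerProductSpace ℂ X]
  [NormedAddCommGroup U] [InnerProductSpace ℂ U]
  [NormedAddCommGroup Y] [InnerProductSpace ℂ Y]

theorem inner_blockOp_diag (H : X →L[ℂ] X) (v w : WithLp 2 (X × U)) :
    inner ℂ (blockOp H 0 0 (ContinuousLinearMap.id ℂ U) v) w =
      inner ℂ (H v.fst) w.fst + inner ℂ v.snd w.snd := by
  simp [blockOp, WithLp.prod_inner_apply]

theorem isSelfAdjoint_blockOp_diag [CompleteSpace X] [CompleteSpace U] {H : X →L[ℂ] X}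
    (hH : IsSelfAdjoint H) : IsSelfAdjoint (blockOp H 0 0 (ContinuousLinearMap.id ℂ U)) := by
  rw [ContinuousLinearMap.isSelfAdjoint_iff_isSymmetric]
  intro v w
  have h1 : inner ℂ (H v.fst) w.fst = inner ℂ v.fst (H w.fst) :=
    ContinuousLinearMap.isSelfAdjoint_iff_isSymmetric.1 hH v.fst w.fst
  rw [ContinuousLinearMap.coe_coe, inner_blockOp_diag, ← inner_conj_symm v, inner_blockOp_diag,
    map_add, inner_conj_symm, inner_conj_symm, h1]

theorem re_inner_blockOp_diag (H : X →L[ℂ] X) (v : WithLp 2 (X × U)) :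
    (inner ℂ (blockOp H 0 0 (ContinuousLinearMap.id ℂ U) v) v).re =
      quadForm H v.fst + ‖v.snd‖ ^ 2 := by
  rw [inner_blockOp_diag, Complex.add_re, quadForm, ← inner_self_eq_norm_sq (𝕜 := ℂ)]
  rfl

/-- The KYP inequality is the dissipation inequality of the storage function `⟨Hx, x⟩`. -/
theorem kypInequality_iff [CompleteSpace X] [CompleteSpace U] [CompleteSpace Y]
    {A : X →L[ℂ] X} {B : U →L[ℂ] X} {C : X →L[ℂ] Y} {D : U →L[ℂ] Y}
    {H : X →L[ℂ] X} (hH : IsSelfAdjoint H) :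
    KYPInequality A B C D H ↔ ∀ x u,
      quadForm H (A x + B u) + ‖C x + D u‖ ^ 2 ≤ quadForm H x + ‖u‖ ^ 2 := by
  have h1 := isSelfAdjoint_blockOp_diag (U := U) hH
  have h2 := (isSelfAdjoint_blockOp_diag (U := Y) hH).adjoint_conj (blockOp A B C D)
  rw [KYPInequality, ContinuousLinearMap.le_def, ContinuousLinearMap.isPositive_def']
  refine (and_iff_right (h1.sub h2)).trans ?_
  have key : ∀ v : WithLp 2 (X × U), (blockOp H 0 0 (ContinuousLinearMap.id ℂ U) -
      ContinuousLinearMap.adjoint (blockOp A B C D) ∘L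
        blockOp H 0 0 (ContinuousLinearMap.id ℂ Y) ∘L blockOp A B C D).reApplyInnerSelf v =
      quadForm H v.fst + ‖v.snd‖ ^ 2 -
        (quadForm H (A v.fst + B v.snd) + ‖C v.fst + D v.snd‖ ^ 2) := by
    intro v
    rw [reApplyInnerSelf, sub_apply, inner_sub_left, comp_apply, adjoint_inner_left, map_sub,
      comp_apply]
    exact congrArg₂ _ (re_inner_blockOp_diag H v) (re_inner_blockOp_diag H (blockOp A B C D v))
  refine ⟨fun h x u => ?_, fun h v => ?_⟩
  · have := h (WithLp.toLp 2 (x, u))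
    rw [key] at this
    exact sub_nonneg.1 this
  · rw [key]
    exact sub_nonneg.2 (h _ _)

/-- The two-sided telescoping of the dissipation inequality along the Green's function. -/
theorem norm_observabilityOp_sq_le [CompleteSpace X] {A : X →L[ℂ] X} {C : X →L[ℂ] Y} {H : X →L[ℂ] X}
    (hA : HasDichotomy A) (hd : ∀ x, quadForm H (A x) + ‖C x‖ ^ 2 ≤ quadForm H x) (x : X) :
    ‖observabilityOp C A x‖ ^ 2 ≤
      quadForm H (rieszProjection A x) - quadForm H ((1 - rieszProjection A) x) := by
  set w := greenOp A x with hw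
  have hW : observabilityOp C A x = diagOp C w := rfl
  have hP : rieszProjection A x = w 0 := rieszProjection_apply hA x
  have hQ : quadForm H ((1 - rieszProjection A) x) = quadForm H (A (w (-1))) := by
    have h0 := greenOp_sub hA x 0
    rw [if_pos rfl, ← hw, zero_sub] at h0
    have : (1 - rieszProjection A) x = -A (w (-1)) := by
      rw [sub_apply, one_apply_eq_self, hP, ← h0]; abel
    rw [this, quadForm, quadForm, map_neg, inner_neg_neg]
  set a : ℤ → ℝ := fun n => quadForm H (w n) with ha
  have hsa : Summable a :=
    Summable.of_norm_bounded ((lp.memℓp w).summable_norm_sq.mul_left ‖H‖)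
      fun n => abs_quadForm_le H (w n)
  have hsa1 : Summable fun n => a (n + 1) := (Equiv.addRight (1 : ℤ)).summable_iff.2 hsa
  set j : ℝ := a 0 - quadForm H (A (w (-1))) with hj
  have hsj : HasSum (Pi.single (-1) j : ℤ → ℝ) j := hasSum_pi_single (-1) j
  have hle : ∀ n, ‖diagOp C w n‖ ^ 2 ≤ a n - a (n + 1) + (Pi.single (-1) j : ℤ → ℝ) n := by
    intro n
    have h1 : quadForm H (A (w n)) + ‖diagOp C w n‖ ^ 2 ≤ a n := hd (w n)
    rcases eq_or_ne n (-1) with rfl | hn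
    · simp only [Pi.single_eq_same, hj, neg_add_cancel]
      linarith
    · rw [Pi.single_eq_of_ne hn]
      have h2 : a (n + 1) = quadForm H (A (w n)) := by rw [ha]; simp only [hw, greenOp_succ hA x hn]
      linarith
  have hs := (hsa.hasSum.sub hsa1.hasSum).add hsj
  have e : ∑' n, a (n + 1) = ∑' n, a n := (Equiv.addRight (1 : ℤ)).tsum_eq a
  rw [e, sub_self, zero_add] at hs
  rw [hW, norm_sq_eq_tsum, hP, hQ]
  exact hasSum_le hle (lp.memℓp (diagOp C w)).summable_norm_sq.hasSum hs

/-- Exact observability makes the observability operator bounded below. -/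
theorem ExactlyObservable.exists_le [CompleteSpace X] [CompleteSpace Y] {A : X →L[ℂ] X}
    {C : X →L[ℂ] Y}
    (ho : ExactlyObservable C A) :
    ∃ ε : ℝ, 0 < ε ∧ ∀ x, ε * ‖x‖ ^ 2 ≤ ‖observabilityOp C A x‖ ^ 2 := by
  obtain ⟨K, hK, h⟩ := (adjoint (observabilityOp C A)).exists_preimage_norm_le ho
  refine ⟨(K ^ 2)⁻¹, by positivity, fun x => ?_⟩
  obtain ⟨v, hv, hn⟩ := h x
  have h1 : ‖x‖ ^ 2 ≤ ‖observabilityOp C A x‖ * (K * ‖x‖) := by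
    calc ‖x‖ ^ 2 = ‖inner ℂ x x‖ := by rw [inner_self_eq_norm_sq_to_K]; simp
      _ = ‖inner ℂ (observabilityOp C A x) v‖ := by
        conv_lhs => rw [← hv, adjoint_inner_left]
        rw [hv, norm_inner_symm]
      _ ≤ ‖observabilityOp C A x‖ * ‖v‖ := norm_inner_le_norm _ _
      _ ≤ _ := by gcongr
  have h2 : ‖x‖ ≤ K * ‖observabilityOp C A x‖ := by
    rcases eq_or_ne x 0 with rfl | hx
    · simp
    · exact le_of_mul_le_mul_right (by linarith) (norm_pos_iff.2 hx)
  rw [inv_mul_le_iff₀ (by positivity), ← mul_pow]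
  exact pow_le_pow_left₀ (norm_nonneg _) h2 2

/-- Under exact observability, a storage form is uniformly indefinite with respect to the
dichotomy of `A`. -/
theorem exists_le_quadForm_sub [CompleteSpace X] [CompleteSpace Y] {A : X →L[ℂ] X}
    {C : X →L[ℂ] Y} {H : X →L[ℂ] X}
    (hA : HasDichotomy A) (ho : ExactlyObservable C A)
    (hd : ∀ x, quadForm H (A x) + ‖C x‖ ^ 2 ≤ quadForm H x) :
    ∃ ε : ℝ, 0 < ε ∧ ∀ x, ε * ‖x‖ ^ 2 ≤
      quadForm H (rieszProjection A x) - quadForm H ((1 - rieszProjection A) x) := by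
  obtain ⟨ε, hε, h⟩ := ho.exists_le
  exact ⟨ε, hε, fun x => (h x).trans (norm_observabilityOp_sq_le hA hd x)⟩

/-- Every selfadjoint solution of the dissipation inequality is invertible: the real part of
`⟨Hx, Px - (1-P)x⟩` is the difference of the forms of the two components of `x`. -/
theorem isUnit_of_dissipation [CompleteSpace X] [CompleteSpace Y] {A : X →L[ℂ] X}
    {C : X →L[ℂ] Y} {H : X →L[ℂ] X}
    (hA : HasDichotomy A) (ho : ExactlyObservable C A) (hH : IsSelfAdjoint H)
    (hd : ∀ x, quadForm H (A x) + ‖C x‖ ^ 2 ≤ quadForm H x) : IsUnit H := by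
  obtain ⟨ε, hε, h⟩ := exists_le_quadForm_sub hA ho hd
  refine isUnit_of_le_re_inner (T := rieszProjection A - (1 - rieszProjection A)) hH hε
    fun x => (h x).trans_eq ?_
  set a := rieszProjection A x
  set b := (1 - rieszProjection A) x
  have hx : x = a + b := by simp [a, b]
  have hs : inner ℂ (H a) b = (starRingEnd ℂ) (inner ℂ (H b) a) := by
    rw [inner_conj_symm]
    exact ContinuousLinearMap.isSelfAdjoint_iff_isSymmetric.1 hH a b
  have : (rieszProjection A - (1 - rieszProjection A)) x = a - b := rfl
  rw [this]
  conv_rhs => rw [hx]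
  rw [map_add, inner_add_left, inner_sub_right, inner_sub_right, hs, quadForm, quadForm]
  simp only [Complex.add_re, Complex.sub_re, Complex.conj_re]
  ring

end Dissipation

/-! ### Hilbert space dimension -/

section Dimension

universe v

open Cardinal

variable {E F : Type v} [NormedAddCommGroup E] [InnerProductSpace ℂ E]
  [NormedAddCommGroup F] [InnerProductSpace ℂ F]

theorem countable_inner_hilbertBasis_ne_zero {ι : Type*} (b : HilbertBasis ι ℂ E) (x : E) :
    {i | inner ℂ x (b i) ≠ 0}.Countable := by
  have h : Summable fun i => ‖b.repr x i‖ ^ 2 := by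
    have := (memℓp_gen_iff (p := 2) (by norm_num)).1 (lp.memℓp (b.repr x))
    simpa using this
  refine h.countable_support.mono fun i hi => ?_
  simp only [Function.mem_support, b.repr_apply_apply]
  have : inner ℂ (b i) x ≠ 0 := by rwa [← inner_conj_symm, ne_eq, map_eq_zero]
  positivity

/-- A bounded injection does not decrease the cardinality of Hilbert bases. In infinite dimension,
every basis vector `b i` of `E` pairs nontrivially with some `T^* c k`, and each `k` accounts for
countably many `i`. -/
theorem mk_le_mk_of_injective [CompleteSpace E] [CompleteSpace F] {ι κ : Type v}
    (b : HilbertBasis ι ℂ E) (c : HilbertBasis κ ℂ F)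
    (T : E →L[ℂ] F) (hT : Function.Injective T) : #ι ≤ #κ := by
  rcases finite_or_infinite κ with hκ | hκ
  · have hfin : FiniteDimensional ℂ F := by
      have hd := c.dense_span
      have : FiniteDimensional ℂ (Submodule.span ℂ (Set.range c)) :=
        FiniteDimensional.span_of_finite ℂ (Set.finite_range c)
      rw [(Submodule.closed_of_finiteDimensional _).submodule_topologicalClosure_eq] at hd
      rw [hd] at this
      exact (Submodule.topEquiv (R := ℂ) (M := F)).finiteDimensional
    have hli : LinearIndependent ℂ (T ∘ b) :=
      b.orthonormal.linearIndependent.map' T.toLinearMap (LinearMap.ker_eq_bot.2 hT)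
    have h1 := hli.cardinal_le_rank
    have hspan : Module.rank ℂ F ≤ #κ := by
      have hd := c.dense_span
      rw [(Submodule.closed_of_finiteDimensional _).submodule_topologicalClosure_eq] at hd
      rw [← rank_top ℂ F, ← hd]
      exact (rank_span_le _).trans mk_range_le
    exact h1.trans hspan
  · have hcov : (Set.univ : Set ι) ⊆
        ⋃ k, {i | inner ℂ (ContinuousLinearMap.adjoint T (c k)) (b i) ≠ 0} := by
      intro i _
      rw [Set.mem_iUnion]
      by_contra! hall
      have hz : T (b i) = 0 := by
        refine c.repr.injective (lp.ext (funext fun k => ?_))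
        rw [map_zero, c.repr_apply_apply, ← ContinuousLinearMap.adjoint_inner_left]
        simpa using hall k
      have h0 : b i = 0 := hT (by rw [hz, map_zero])
      have := b.orthonormal.1 i
      rw [h0, norm_zero] at this
      exact zero_ne_one this
    calc #ι = #(Set.univ : Set ι) := mk_univ.symm
      _ ≤ _ := mk_le_mk_of_subset hcov
      _ ≤ Cardinal.sum fun k : κ =>
          #{i | inner ℂ (ContinuousLinearMap.adjoint T (c k)) (b i) ≠ 0} := mk_iUnion_le_sum_mk
      _ ≤ Cardinal.sum fun _ : κ => ℵ₀ :=
        sum_le_sum _ _ fun k => (countable_inner_hilbertBasis_ne_zero b _).le_aleph0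
      _ = #κ * ℵ₀ := sum_const' _ _
      _ = #κ := mul_aleph0_eq (aleph0_le_mk κ)

/-- A bounded injection between Hilbert spaces does not decrease the Hilbert space dimension. -/
theorem hilbertDim_le_of_injective [CompleteSpace E] [CompleteSpace F] (T : E →L[ℂ] F)
    (hT : Function.Injective T) :
    hilbertDim E ≤ hilbertDim F := by
  obtain ⟨w, b, -⟩ := exists_hilbertBasis ℂ E
  obtain ⟨w', b', -⟩ := exists_hilbertBasis ℂ F
  refine le_csInf ⟨#w', w', ⟨b'⟩, rfl⟩ ?_
  rintro _ ⟨κ, ⟨c⟩, rfl⟩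
  have hE : hilbertDim E ≤ #w := csInf_le' ⟨w, ⟨b⟩, rfl⟩
  exact hE.trans (mk_le_mk_of_injective b c T hT)

theorem hilbertDim_range_le {X : Type v} [NormedAddCommGroup X] [InnerProductSpace ℂ X]
    [CompleteSpace X] {S T : X →L[ℂ] X} (hS : IsIdempotentElem S) (hT : IsIdempotentElem T)
    (h : ∀ x, S x = x → T x = 0 → x = 0) : hilbertDim S.range ≤ hilbertDim T.range := by
  have hc : ∀ {R : X →L[ℂ] X}, IsIdempotentElem R → CompleteSpace R.range := by
    intro R hR
    have : (R.range : Set X) = {x | R x = x} := by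
      ext x
      refine ⟨?_, fun hx => ⟨x, hx⟩⟩
      rintro ⟨y, rfl⟩
      exact DFunLike.congr_fun hR y
    have hcl : IsClosed (R.range : Set X) := by
      rw [this]; exact isClosed_eq R.continuous continuous_id
    exact hcl.completeSpace_coe
  have := hc hS
  have := hc hT
  refine hilbertDim_le_of_injective
    ((T ∘L S.range.subtypeL).codRestrict T.range fun x => ⟨x, rfl⟩) ?_
  rw [injective_iff_map_eq_zero]
  rintro ⟨_, y, rfl⟩ hy
  have h1 : T (S y) = 0 := congrArg Subtype.val hy
  exact Subtype.ext (h (S y) (DFunLike.congr_fun hS y) h1)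

end Dimension

/-! ### Inertia of the solutions -/

section Inertia

open ContinuousLinearMap Filter

universe v

variable {X : Type v} {Y : Type*} [NormedAddCommGroup X] [InnerProductSpace ℂ X]
  [NormedAddCommGroup Y] [InnerProductSpace ℂ Y]

theorem continuousOn_indicator_spectrum {H : X →L[ℂ] X} (hu : IsUnit H) {s : Set ℝ}
    (hs : frontier s ⊆ {0}) :
    ContinuousOn (Set.indicator s 1 : ℝ → ℝ) (spectrum ℝ H) := by
  intro r hr
  have h0 : r ≠ 0 := by
    rintro rfl
    exact spectrum.zero_notMem ℝ hu hr
  have hf : r ∉ frontier s := fun h => h0 (hs h)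
  refine ContinuousAt.continuousWithinAt ?_
  by_cases hc : r ∈ closure s
  · have hi : r ∈ interior s := by
      by_contra hi
      exact hf ⟨hc, hi⟩
    refine (continuousAt_const (y := (1 : ℝ))).congr ?_
    filter_upwards [mem_interior_iff_mem_nhds.1 hi] with t ht
    simp [ht]
  · refine (continuousAt_const (y := (0 : ℝ))).congr ?_
    filter_upwards [isClosed_closure.isOpen_compl.mem_nhds hc] with t ht
    exact (Set.indicator_of_notMem (fun h => ht (subset_closure h)) _).symm

theorem isIdempotentElem_cfc_indicator [CompleteSpace X] {H : X →L[ℂ] X} (hu : IsUnit H)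
    {s : Set ℝ} (hs : frontier s ⊆ {0}) :
    IsIdempotentElem (cfc (Set.indicator s 1 : ℝ → ℝ) H) := by
  have hc := continuousOn_indicator_spectrum hu hs
  rw [IsIdempotentElem, ← cfc_mul _ _ H hc hc]
  congr 1
  ext r
  by_cases h : r ∈ s <;> simp [h]

/-- On the spectral subspace of `H` for a set on which `σ r ≥ 0`, the form `σ ⟨Hx, x⟩` is
nonnegative. -/
theorem quadForm_nonneg_of_cfc_indicator [CompleteSpace X] {H : X →L[ℂ] X}
    (hH : IsSelfAdjoint H) (hu : IsUnit H)
    {s : Set ℝ} (hs : frontier s ⊆ {0}) {σ : ℝ} (hσ : ∀ r ∈ s, 0 ≤ σ * r) {x : X}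
    (hx : cfc (Set.indicator s 1 : ℝ → ℝ) H x = x) : 0 ≤ σ * quadForm H x := by
  have hc := continuousOn_indicator_spectrum hu hs
  have hpos : 0 ≤ cfc (fun r : ℝ => σ * (r * Set.indicator s 1 r)) H := by
    refine cfc_nonneg fun r _ => ?_
    by_cases h : r ∈ s
    · simpa [h] using hσ r h
    · simp [h]
  have heq : cfc (fun r : ℝ => σ * (r * Set.indicator s 1 r)) H =
      σ • (H * cfc (Set.indicator s 1 : ℝ → ℝ) H) := by
    rw [cfc_const_mul σ (fun r : ℝ => r * Set.indicator s 1 r) H (continuousOn_id.mul hc),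
      cfc_mul (fun r : ℝ => r) _ H continuousOn_id hc]
    congr 2
    exact cfc_id' ℝ H
  rw [heq, ContinuousLinearMap.nonneg_iff_isPositive] at hpos
  have h := hpos.re_inner_nonneg_left x
  have e : (σ • (H * cfc (Set.indicator s 1 : ℝ → ℝ) H)) x = (σ : ℂ) • H x := by
    rw [smul_apply, mul_apply_eq_comp, hx, Complex.coe_smul]
  rw [e, inner_smul_left, Complex.conj_ofReal] at h
  simpa [quadForm] using h

theorem cfc_indicator_pos_add_neg [CompleteSpace X] {H : X →L[ℂ] X} (hH : IsSelfAdjoint H)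
    (hu : IsUnit H) :
    cfc (Set.indicator (Set.Ioi (0 : ℝ)) 1 : ℝ → ℝ) H +
      cfc (Set.indicator (Set.Iio (0 : ℝ)) 1 : ℝ → ℝ) H = 1 := by
  rw [← cfc_add H _ _ (continuousOn_indicator_spectrum hu (by simp))
    (continuousOn_indicator_spectrum hu (by simp)), ← cfc_one ℝ H]
  refine cfc_congr fun r hr => ?_
  have h0 : r ≠ 0 := by
    rintro rfl
    exact spectrum.zero_notMem ℝ hu hr
  rcases lt_or_gt_of_ne h0 with h | h
  · simp [h, h.le]
  · simp [h, h.le]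

/-- The inertia theorem: the spectral subspaces of `A` and those of a storage operator `H` have
the same dimensions. Each spectral projection of one operator is injective on the corresponding
spectral subspace of the other, since a vector in its kernel would have both signs of the form. -/
theorem hilbertDim_spectralSubspace_eq [CompleteSpace X] [CompleteSpace Y] {A : X →L[ℂ] X}
    {C : X →L[ℂ] Y} {H : X →L[ℂ] X}
    (hA : HasDichotomy A) (ho : ExactlyObservable C A) (hH : IsSelfAdjoint H) (hu : IsUnit H)
    (hd : ∀ x, quadForm H (A x) + ‖C x‖ ^ 2 ≤ quadForm H x) :
    hilbertDim (spectralSubspaceDisk A) = hilbertDim (spectralSubspacePos H) ∧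
      hilbertDim (spectralSubspaceExterior A) = hilbertDim (spectralSubspaceNeg H) := by
  obtain ⟨ε, hε, hform⟩ := exists_le_quadForm_sub hA ho hd
  have hP : IsIdempotentElem (rieszProjection A) :=
    ContinuousLinearMap.ext fun x => rieszProjection_idem hA x
  have hfp : frontier (Set.Ioi (0 : ℝ)) ⊆ {0} := by simp
  have hfn : frontier (Set.Iio (0 : ℝ)) ⊆ {0} := by simp
  set P := rieszProjection A
  set Qp := cfc (Set.indicator (Set.Ioi (0 : ℝ)) 1 : ℝ → ℝ) H with hQp
  set Qn := cfc (Set.indicator (Set.Iio (0 : ℝ)) 1 : ℝ → ℝ) H with hQn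
  have hsum : ∀ x, Qp x + Qn x = x := fun x =>
    DFunLike.congr_fun (cfc_indicator_pos_add_neg hH hu) x
  have hpos : ∀ x, Qp x = x → 0 ≤ quadForm H x := fun x hx => by
    simpa using quadForm_nonneg_of_cfc_indicator hH hu hfp (σ := 1)
      (fun r hr => by simpa using (Set.mem_Ioi.1 hr).le) hx
  have hneg : ∀ x, Qn x = x → quadForm H x ≤ 0 := fun x hx => by
    simpa using quadForm_nonneg_of_cfc_indicator hH hu hfn (σ := -1)
      (fun r hr => by simpa using (Set.mem_Iio.1 hr).le) hx
  have h0 : quadForm H 0 = 0 := by simp [quadForm]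
  have hzero : ∀ x : X, ε * ‖x‖ ^ 2 ≤ 0 → x = 0 := fun x hx => by
    have : ‖x‖ ^ 2 ≤ 0 := nonpos_of_mul_nonpos_right hx hε
    exact norm_eq_zero.1 (pow_eq_zero_iff two_ne_zero |>.1 (le_antisymm this (sq_nonneg _)))
  have hfix : ∀ x, P x = x → quadForm H x ≤ 0 → x = 0 := fun x hx hq => by
    have h := hform x
    have : (1 - P) x = 0 := by rw [sub_apply, one_apply_eq_self, hx, sub_self]
    rw [hx, this, h0, sub_zero] at h
    exact hzero x (h.trans hq)
  have hker : ∀ x, P x = 0 → 0 ≤ quadForm H x → x = 0 := fun x hx hq => by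
    have h := hform x
    have : (1 - P) x = x := by rw [sub_apply, one_apply_eq_self, hx, sub_zero]
    rw [hx, this, h0, zero_sub] at h
    exact hzero x (h.trans (neg_nonpos.2 hq))
  have hker1 : ∀ x, (1 - P) x = x → P x = 0 := fun x hx => by
    rwa [sub_apply, one_apply_eq_self, sub_eq_self] at hx
  have hfix1 : ∀ x, (1 - P) x = 0 → P x = x := fun x hx => by
    rw [sub_apply, one_apply_eq_self, sub_eq_zero] at hx
    exact hx.symm
  have hn : ∀ x, Qp x = 0 → Qn x = x := fun x hx => by
    have := hsum x
    rwa [hx, zero_add] at this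
  have hp : ∀ x, Qn x = 0 → Qp x = x := fun x hx => by
    have := hsum x
    rwa [hx, add_zero] at this
  have hQpi := isIdempotentElem_cfc_indicator hu hfp
  have hQni := isIdempotentElem_cfc_indicator hu hfn
  refine ⟨le_antisymm ?_ ?_, le_antisymm ?_ ?_⟩
  · exact hilbertDim_range_le hP hQpi fun x hx hq => hfix x hx (hneg x (hn x hq))
  · exact hilbertDim_range_le hQpi hP fun x hq hx => hker x hx (hpos x hq)
  · exact hilbertDim_range_le hP.one_sub hQni fun x hx hq => hker x (hker1 x hx) (hpos x (hp x hq))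
  · exact hilbertDim_range_le hQni hP.one_sub fun x hq hx => hfix x (hfix1 x hx) (hneg x hq)

end Inertia

/-! ### The available storage -/

section Storage

variable {X U Y : Type*}
  [NormedAddCommGroup X] [InnerProductSpace ℂ X]
  [NormedAddCommGroup U] [InnerProductSpace ℂ U]
  [NormedAddCommGroup Y] [InnerProductSpace ℂ Y]
  {A : X →L[ℂ] X} {B : U →L[ℂ] X} {C : X →L[ℂ] Y} {D : U →L[ℂ] Y}
  {u u' : ℤ → U} {x x' : ℤ → X}

theorem IsTrajectory.add (h : IsTrajectory A B u x) (h' : IsTrajectory A B u' x') :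
    IsTrajectory A B (u + u') (x + x') :=
  ⟨h.memlp_input.add h'.memlp_input, h.memlp_state.add h'.memlp_state, fun n => by
    simp only [Pi.add_apply, h.state_eq, h'.state_eq, map_add]; abel⟩

theorem IsTrajectory.smul (h : IsTrajectory A B u x) (c : ℂ) :
    IsTrajectory A B (c • u) (c • x) :=
  ⟨h.memlp_input.const_smul c, h.memlp_state.const_smul c, fun n => by
    simp only [Pi.smul_apply, h.state_eq, map_smul, smul_add]⟩

theorem IsTrajectory.sub (h : IsTrajectory A B u x) (h' : IsTrajectory A B u' x') :
    IsTrajectory A B (u - u') (x - x') := by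
  have := h.add (h'.smul (-1))
  simpa only [neg_one_smul, ← sub_eq_add_neg] using this

/-- Two trajectories with the same state at time `0` can be concatenated there. -/
theorem IsTrajectory.concat (h' : IsTrajectory A B u' x') (h : IsTrajectory A B u x)
    (h0 : x' 0 = x 0) :
    IsTrajectory A B (fun n => if n < 0 then u' n else u n)
      (fun n => if n < 0 then x' n else x n) := by
  refine ⟨memlp_ite _ h'.memlp_input h.memlp_input, memlp_ite _ h'.memlp_state h.memlp_state,
    fun n => ?_⟩
  rcases lt_trichotomy n (-1) with hn | rfl | hn
  · rw [if_pos (by omega), if_pos (by omega), if_pos (by omega), h'.state_eq]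
  · simp [← h0, ← h'.state_eq]
  · rw [if_neg (by omega), if_neg (by omega), if_neg (by omega), h.state_eq]

theorem IsTrajectory.delay (h : IsTrajectory A B u x) :
    IsTrajectory A B (fun n => u (n - 1)) (fun n => x (n - 1)) :=
  ⟨memlp_comp_equiv (Equiv.subRight 1) h.memlp_input,
    memlp_comp_equiv (Equiv.subRight 1) h.memlp_state, fun n => by
    rw [add_sub_cancel_right, ← h.state_eq, sub_add_cancel]⟩

/-- The energy surplus `‖y(n)‖² - ‖u(n)‖²` at time `n`. -/
def surplus (C : X →L[ℂ] Y) (D : U →L[ℂ] Y) (u : ℤ → U) (x : ℤ → X) (n : ℤ) : ℝ :=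
  ‖C (x n) + D (u n)‖ ^ 2 - ‖u n‖ ^ 2

/-- The energy extracted over the times `n ≥ 0`. -/
def futureSurplus (C : X →L[ℂ] Y) (D : U →L[ℂ] Y) (u : ℤ → U) (x : ℤ → X) : ℝ :=
  ∑' k : ℕ, surplus C D u x k

theorem IsTrajectory.summable_surplus (h : IsTrajectory A B u x) :
    Summable (surplus C D u x) :=
  (h.memlp_output C D).summable_norm_sq.sub h.memlp_input.summable_norm_sq

theorem IsTrajectory.summable_future (h : IsTrajectory A B u x) :
    Summable fun k : ℕ => surplus C D u x k :=
  h.summable_surplus.comp_injective Nat.cast_injective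

theorem neg_norm_sq_le_surplus (n : ℤ) : -‖u n‖ ^ 2 ≤ surplus C D u x n := by
  unfold surplus
  linarith [sq_nonneg ‖C (x n) + D (u n)‖]

theorem IsTrajectory.neg_input_le_futureSurplus (h : IsTrajectory A B u x) :
    -∑' n, ‖u n‖ ^ 2 ≤ futureSurplus C D u x := by
  have hs := h.memlp_input.summable_norm_sq
  have h1 : ∑' k : ℕ, ‖u k‖ ^ 2 ≤ ∑' n, ‖u n‖ ^ 2 :=
    tsum_comp_le_tsum_of_inj hs (fun n => sq_nonneg _) Nat.cast_injective
  have h2 : ∑' k : ℕ, -‖u k‖ ^ 2 ≤ futureSurplus C D u x :=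
    (hs.comp_injective Nat.cast_injective).neg.tsum_le_tsum
      (fun k => neg_norm_sq_le_surplus (k : ℤ)) h.summable_future
  rw [tsum_neg] at h2
  linarith

/-- The energy extracted in the future by one trajectory is at most the input energy spent by any
other trajectory on reaching the same state at time `0`. -/
theorem IsTrajectory.futureSurplus_le (hcon : ∀ u x, IsTrajectory A B u x →
      ∑' n, ‖C (x n) + D (u n)‖ ^ 2 ≤ ∑' n, ‖u n‖ ^ 2)
    (h : IsTrajectory A B u x) (h' : IsTrajectory A B u' x') (h0 : x' 0 = x 0) :
    futureSurplus C D u x ≤ ∑' n, ‖u' n‖ ^ 2 := by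
  have ht := h'.concat h h0
  set v : ℤ → U := fun n => if n < 0 then u' n else u n with hv
  set w : ℤ → X := fun n => if n < 0 then x' n else x n with hw
  have hsum : Summable (surplus C D v w) := ht.summable_surplus
  have hneg : ∑' n, surplus C D v w n ≤ 0 := by
    have := hcon _ _ ht
    unfold surplus
    rw [(ht.memlp_output C D).summable_norm_sq.tsum_sub ht.memlp_input.summable_norm_sq]
    linarith
  have hinj : Function.Injective fun k : ℕ => -((k : ℤ) + 1) := fun a b hab => by
    simp only at hab; omega
  have hpast : Summable fun k : ℕ => surplus C D v w (-((k : ℤ) + 1)) :=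
    hsum.comp_injective hinj
  rw [tsum_of_nat_of_neg_add_one ht.summable_future hpast] at hneg
  have hfut : ∑' k : ℕ, surplus C D v w k = futureSurplus C D u x := by
    refine tsum_congr fun k => ?_
    have hk : ¬ (k : ℤ) < 0 := by omega
    simp only [surplus, hv, hw, if_neg hk]
  have hs := h'.memlp_input.summable_norm_sq
  have h1 : ∑' k : ℕ, -‖u' (-((k : ℤ) + 1))‖ ^ 2 ≤ ∑' k : ℕ, surplus C D v w (-((k : ℤ) + 1)) := by
    refine (hs.comp_injective hinj).neg.tsum_le_tsum (fun k => ?_) hpast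
    have e : u' (-((k : ℤ) + 1)) = v (-((k : ℤ) + 1)) := by
      rw [hv]; exact (if_pos (by omega)).symm
    rw [e]
    exact neg_norm_sq_le_surplus _
  rw [tsum_neg] at h1
  have h2 : ∑' k : ℕ, ‖u' (-((k : ℤ) + 1))‖ ^ 2 ≤ ∑' n, ‖u' n‖ ^ 2 :=
    tsum_comp_le_tsum_of_inj hs (fun n => sq_nonneg _) hinj
  linarith

theorem futureSurplus_smul (c : ℂ) :
    futureSurplus C D (c • u) (c • x) = ‖c‖ ^ 2 * futureSurplus C D u x := by
  rw [futureSurplus, futureSurplus, ← tsum_mul_left]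
  refine tsum_congr fun k => ?_
  simp only [surplus, Pi.smul_apply, map_smul, ← smul_add, norm_smul]
  ring

theorem IsTrajectory.futureSurplus_parallelogram (h : IsTrajectory A B u x)
    (h' : IsTrajectory A B u' x') :
    futureSurplus C D (u + u') (x + x') + futureSurplus C D (u - u') (x - x') =
      2 * futureSurplus C D u x + 2 * futureSurplus C D u' x' := by
  unfold futureSurplus
  rw [← (h.add h').summable_future.tsum_add (h.sub h').summable_future, ← tsum_mul_left,
    ← tsum_mul_left, ← (h.summable_future.mul_left 2).tsum_add (h'.summable_future.mul_left 2)]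
  refine tsum_congr fun k => ?_
  have h1 := parallelogram_law_with_norm ℂ (u k) (u' k)
  have h2 := parallelogram_law_with_norm ℂ (C (x k) + D (u k)) (C (x' k) + D (u' k))
  simp only [surplus, Pi.add_apply, Pi.sub_apply, map_add, map_sub]
  rw [show C (x k) + C (x' k) + (D (u k) + D (u' k)) =
      C (x k) + D (u k) + (C (x' k) + D (u' k)) by abel,
    show C (x k) - C (x' k) + (D (u k) - D (u' k)) =
      C (x k) + D (u k) - (C (x' k) + D (u' k)) by abel]
  linarith

/-- The available storage of a state `x₀`: the supremum of the energy that can be extracted in the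
future along `ℓ²`-trajectories passing through `x₀` at time `0`. -/
def availableStorage (A : X →L[ℂ] X) (B : U →L[ℂ] X) (C : X →L[ℂ] Y) (D : U →L[ℂ] Y) (x₀ : X) :
    ℝ :=
  sSup {j | ∃ u x, IsTrajectory A B u x ∧ x 0 = x₀ ∧ futureSurplus C D u x = j}

variable {K : ℝ}

theorem availableStorage_le (hr : ∀ x₀ : X, ∃ (u : ℤ → U) (x : ℤ → X), IsTrajectory A B u x ∧
      x 0 = x₀ ∧ ∑' n, ‖u n‖ ^ 2 ≤ K * ‖x₀‖ ^ 2) {x₀ : X} {b : ℝ}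
    (h : ∀ u x, IsTrajectory A B u x → x 0 = x₀ → futureSurplus C D u x ≤ b) :
    availableStorage A B C D x₀ ≤ b := by
  obtain ⟨u, x, ht, h0, -⟩ := hr x₀
  refine csSup_le ⟨_, u, x, ht, h0, rfl⟩ ?_
  rintro _ ⟨v, w, hvw, hw, rfl⟩
  exact h v w hvw hw

theorem IsTrajectory.le_availableStorage (hcon : ∀ u x, IsTrajectory A B u x →
      ∑' n, ‖C (x n) + D (u n)‖ ^ 2 ≤ ∑' n, ‖u n‖ ^ 2)
    (h : IsTrajectory A B u x) :
    futureSurplus C D u x ≤ availableStorage A B C D (x 0) := by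
  refine le_csSup ⟨∑' n, ‖u n‖ ^ 2, ?_⟩ ⟨u, x, h, rfl, rfl⟩
  rintro _ ⟨v, w, hvw, hw, rfl⟩
  exact hvw.futureSurplus_le hcon h hw.symm

/-- The available storage of a contractive, exactly controllable system is a bounded quadratic form
satisfying the dissipation inequality. It is bounded above and homogeneous of degree two, a
supremum of quadratic forms over affine fibres satisfies one half of the parallelogram law, and the
other half follows by substitution. -/
theorem exists_storage [CompleteSpace X]
    (hcon : ∀ u x, IsTrajectory A B u x →
      ∑' n, ‖C (x n) + D (u n)‖ ^ 2 ≤ ∑' n, ‖u n‖ ^ 2)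
    (hr : ∀ x₀ : X, ∃ (u : ℤ → U) (x : ℤ → X), IsTrajectory A B u x ∧
      x 0 = x₀ ∧ ∑' n, ‖u n‖ ^ 2 ≤ K * ‖x₀‖ ^ 2) :
    ∃ H : X →L[ℂ] X, IsSelfAdjoint H ∧ ∀ x u,
      quadForm H (A x + B u) + ‖C x + D u‖ ^ 2 ≤ quadForm H x + ‖u‖ ^ 2 := by
  set S := availableStorage A B C D with hS
  have hle : ∀ {u x}, IsTrajectory A B u x → futureSurplus C D u x ≤ S (x 0) :=
    fun h => h.le_availableStorage hcon
  have hbound : ∀ x₀, |S x₀| ≤ K * ‖x₀‖ ^ 2 := by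
    intro x₀
    obtain ⟨u, x, ht, rfl, hn⟩ := hr x₀
    refine abs_le.2 ⟨?_, ?_⟩
    · linarith [hle ht, ht.neg_input_le_futureSurplus (C := C) (D := D)]
    · exact (availableStorage_le hr fun v w hvw hw =>
        hvw.futureSurplus_le hcon ht hw.symm).trans hn
  have hS0 : S 0 = 0 := by simpa using hbound 0
  have hsmul_le : ∀ (c : ℂ) x₀, c ≠ 0 → S (c • x₀) ≤ ‖c‖ ^ 2 * S x₀ := by
    intro c x₀ hc
    refine availableStorage_le hr fun u x ht h0 => ?_
    have h1 := hle (ht.smul c⁻¹)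
    rw [Pi.smul_apply, h0, smul_smul, inv_mul_cancel₀ hc, one_smul, futureSurplus_smul, norm_inv,
      inv_pow, inv_mul_le_iff₀ (by positivity)] at h1
    exact h1
  have hsmul : ∀ (c : ℂ) x₀, S (c • x₀) = ‖c‖ ^ 2 * S x₀ := by
    intro c x₀
    rcases eq_or_ne c 0 with rfl | hc
    · simp [hS0]
    refine le_antisymm (hsmul_le c x₀ hc) ?_
    have h1 := hsmul_le c⁻¹ (c • x₀) (inv_ne_zero hc)
    rwa [smul_smul, inv_mul_cancel₀ hc, one_smul, norm_inv, inv_pow,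
      le_inv_mul_iff₀ (by positivity)] at h1
  have hpar_le : ∀ x₀ y₀, 2 * S x₀ + 2 * S y₀ ≤ S (x₀ + y₀) + S (x₀ - y₀) := by
    intro x₀ y₀
    have h1 : ∀ v w, IsTrajectory A B v w → w 0 = y₀ →
        S x₀ ≤ (S (x₀ + y₀) + S (x₀ - y₀) - 2 * futureSurplus C D v w) / 2 := by
      intro v w hvw hw
      refine availableStorage_le hr fun u x ht h0 => ?_
      have h2 := hle (ht.add hvw)
      have h3 := hle (ht.sub hvw)
      have h4 := ht.futureSurplus_parallelogram hvw (C := C) (D := D)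
      rw [Pi.add_apply, h0, hw] at h2
      rw [Pi.sub_apply, h0, hw] at h3
      linarith
    have h5 : S y₀ ≤ (S (x₀ + y₀) + S (x₀ - y₀) - 2 * S x₀) / 2 :=
      availableStorage_le hr fun v w hvw hw => by linarith [h1 v w hvw hw]
    linarith
  have hpar : ∀ x₀ y₀, S (x₀ + y₀) + S (x₀ - y₀) = 2 * S x₀ + 2 * S y₀ := by
    intro x₀ y₀
    refine le_antisymm ?_ (hpar_le x₀ y₀)
    have h1 := hpar_le (x₀ + y₀) (x₀ - y₀)
    have h2 : x₀ + y₀ + (x₀ - y₀) = (2 : ℂ) • x₀ := by rw [two_smul]; abel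
    have h3 : x₀ + y₀ - (x₀ - y₀) = (2 : ℂ) • y₀ := by rw [two_smul]; abel
    rw [h2, h3, hsmul, hsmul] at h1
    norm_num at h1
    linarith
  obtain ⟨H, hH, hq⟩ := exists_quadForm_eq hbound hsmul hpar
  refine ⟨H, hH, fun x₀ u₀ => ?_⟩
  rw [hq, hq]
  have hstep : S (A x₀ + B u₀) ≤ S x₀ + ‖u₀‖ ^ 2 - ‖C x₀ + D u₀‖ ^ 2 := by
    refine availableStorage_le hr fun u x ht h0 => ?_
    obtain ⟨u', x', ht', h0', -⟩ := hr x₀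
    -- reach `x₀` at time `0`, apply `u₀`, then follow the given trajectory with a unit delay
    have hmid : IsTrajectory A B (fun n => if n = 0 then u₀ else if n < 0 then u' n else u (n - 1))
        (fun n => if n ≤ 0 then x' n else x (n - 1)) := by
      have hu₀ : (fun n : ℤ => if n = 0 then u₀ else if n < 0 then u' n else u (n - 1)) =
          fun n => if n = 0 then lp.single (E := fun _ : ℤ => U) 2 0 u₀ n else
            if n < 0 then u' n else u (n - 1) := by
        ext n
        rcases eq_or_ne n 0 with rfl | hn <;> simp [*]
      refine ⟨hu₀ ▸ memlp_ite (fun n => n = 0) (lp.memℓp _)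
          (memlp_ite _ ht'.memlp_input ht.delay.memlp_input),
        memlp_ite _ ht'.memlp_state ht.delay.memlp_state, fun n => ?_⟩
      rcases lt_trichotomy n 0 with hn | rfl | hn
      · rw [if_pos (by omega), if_pos (by omega), if_neg (by omega), if_pos hn, ht'.state_eq]
      · simp [h0, h0']
      · rw [if_neg (by omega), if_neg (by omega), if_neg (by omega), if_neg (by omega),
          ← ht.state_eq, sub_add_cancel, add_sub_cancel_right]
    have h1 := hle hmid
    rw [futureSurplus, hmid.summable_future.tsum_eq_zero_add] at h1
    have h2 : ∀ k : ℕ, surplus C D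
        (fun n => if n = 0 then u₀ else if n < 0 then u' n else u (n - 1))
        (fun n => if n ≤ 0 then x' n else x (n - 1)) ((k + 1 : ℕ) : ℤ) = surplus C D u x k := by
      intro k
      have e1 : ((k + 1 : ℕ) : ℤ) ≠ 0 := by omega
      have e2 : ¬ ((k + 1 : ℕ) : ℤ) < 0 := by omega
      have e3 : ¬ ((k + 1 : ℕ) : ℤ) ≤ 0 := by omega
      have e4 : ((k + 1 : ℕ) : ℤ) - 1 = k := by omega
      simp only [surplus, if_neg e1, if_neg e2, if_neg e3, e4]
    rw [tsum_congr h2] at h1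
    simp only [surplus, Nat.cast_zero, if_true, le_refl, h0'] at h1
    rw [futureSurplus]
    unfold surplus
    linarith
  linarith

end Storage

/-! ### The bound on the transfer function -/

section BoundedReal

open ContinuousLinearMap

variable {X U Y : Type*}
  [NormedAddCommGroup X] [InnerProductSpace ℂ X]
  [NormedAddCommGroup U] [InnerProductSpace ℂ U]
  [NormedAddCommGroup Y] [InnerProductSpace ℂ Y]
  {A : X →L[ℂ] X} {B : U →L[ℂ] X} {C : X →L[ℂ] Y} {D : U →L[ℂ] Y}

theorem supNormOnCircle_le_one_iff {F : ℂ → U →L[ℂ] Y} :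
    supNormOnCircle F ≤ 1 ↔ ∀ z : ℂ, ‖z‖ = 1 → ‖F z‖ ≤ 1 := by
  simp only [supNormOnCircle, iSup_le_iff, mem_sphere_zero_iff_norm]
  refine forall₂_congr fun z _ => ?_
  rw [← ofReal_norm, ENNReal.ofReal_le_one]

/-- The dissipation inequality bounds the transfer function on the circle: for an input `u zⁿ` the
state `x z⁻¹`, `x = z (1 - zA)⁻¹ B u`, has constant storage. -/
theorem norm_transferFunction_le_one {H : X →L[ℂ] X} (hA : HasDichotomy A)
    (hd : ∀ x u, quadForm H (A x + B u) + ‖C x + D u‖ ^ 2 ≤ quadForm H x + ‖u‖ ^ 2)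
    {z : ℂ} (hz : ‖z‖ = 1) : ‖transferFunction A B C D z‖ ≤ 1 := by
  refine opNorm_le_bound _ zero_le_one fun u => ?_
  set R : X →L[ℂ] X := Ring.inverse (1 - z • A) with hR
  set x := z • R (B u) with hx
  have hz0 : z ≠ 0 := by rintro rfl; simp at hz
  have h1 : x - z • A x = z • B u := by
    have : (1 - z • A) (R (B u)) = B u := by
      rw [← mul_apply_eq_comp, hR, Ring.mul_inverse_cancel _ (hA.isUnit_one_sub hz),
        one_apply_eq_self]
    conv_rhs => rw [← this]
    rw [hx, sub_apply, one_apply_eq_self, smul_apply, map_smul, smul_sub]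
  have h2 : A x + B u = z⁻¹ • x := by
    rw [eq_inv_smul_iff₀ hz0, smul_add, ← h1]; abel
  have h3 : C x + D u = transferFunction A B C D z u := by
    simp only [transferFunction, add_apply, smul_apply, comp_apply, hx, map_smul]
    rw [add_comm]
  have h4 : quadForm H (z⁻¹ • x) = quadForm H x := by
    have hzz : (starRingEnd ℂ) z⁻¹ * z⁻¹ = 1 := by
      rw [← Complex.normSq_eq_conj_mul_self, Complex.normSq_eq_norm_sq, norm_inv, hz]; simp
    rw [quadForm, quadForm, map_smul, inner_smul_left, inner_smul_right, ← mul_assoc, hzz, one_mul]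
  have h5 := hd x u
  rw [h2, h3, h4, add_le_add_iff_left] at h5
  rw [one_mul]
  exact le_of_sq_le_sq h5 (norm_nonneg _)

end BoundedReal
end DichotBRL

end

theorem theorem7p1 {X U Y : Type*}
    [NormedAddCommGroup X] [InnerProductSpace ℂ X] [CompleteSpace X]
    [NormedAddCommGroup U] [InnerProductSpace ℂ U] [CompleteSpace U]
    [NormedAddCommGroup Y] [InnerProductSpace ℂ Y] [CompleteSpace Y]
    (A : X →L[ℂ] X) (B : U →L[ℂ] X) (C : X →L[ℂ] Y) (D : U →L[ℂ] Y)
    (hA : DichotBRL.HasDichotomy A)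
    (hc : DichotBRL.ExactlyControllable A B)
    (ho : DichotBRL.ExactlyObservable C A) :
    (DichotBRL.supNormOnCircle (DichotBRL.transferFunction A B C D) ≤ 1 ↔
      ∃ H : X →L[ℂ] X, DichotBRL.IsKYPSolution A B C D H) ∧
    ∀ H : X →L[ℂ] X, DichotBRL.IsKYPSolution A B C D H →
      DichotBRL.hilbertDim (DichotBRL.spectralSubspaceDisk A) =
          DichotBRL.hilbertDim (DichotBRL.spectralSubspacePos H) ∧
        DichotBRL.hilbertDim (DichotBRL.spectralSubspaceExterior A) =
          DichotBRL.hilbertDim (DichotBRL.spectralSubspaceNeg H) := by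
  -- the dissipation inequality with zero input
  have hzero : ∀ {H : X →L[ℂ] X}, (∀ x u, DichotBRL.quadForm H (A x + B u) + ‖C x + D u‖ ^ 2 ≤
      DichotBRL.quadForm H x + ‖u‖ ^ 2) →
      ∀ x, DichotBRL.quadForm H (A x) + ‖C x‖ ^ 2 ≤ DichotBRL.quadForm H x :=
    fun hd x => by simpa using hd x 0
  rw [DichotBRL.supNormOnCircle_le_one_iff]
  refine ⟨⟨fun hF => ?_, ?_⟩, fun H hH => ?_⟩
  · obtain ⟨K, -, hr⟩ := DichotBRL.exists_trajectory_of_state hA hc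
    obtain ⟨H, hH, hd⟩ := DichotBRL.exists_storage (C := C) (D := D)
      (fun u x h => by simpa using h.tsum_output_le hA C D zero_le_one hF) hr
    exact ⟨H, hH, DichotBRL.isUnit_of_dissipation hA ho hH (hzero hd),
      (DichotBRL.kypInequality_iff hH).2 hd⟩
  · rintro ⟨H, hH⟩ z hz
    exact DichotBRL.norm_transferFunction_le_one hA
      ((DichotBRL.kypInequality_iff hH.selfAdjoint).1 hH.kyp) hz
  · exact DichotBRL.hilbertDim_spectralSubspace_eq hA ho hH.selfAdjoint hH.invertible
      (hzero ((DichotBRL.kypInequality_iff hH.selfAdjoint).1 hH.kyp))
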